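/- **Setting.** Let $\Omega\subset\mathbb R^n$ be a bounded open set, $1<p<\infty$, and let $X=(X_1,\dots,X_m)$, $X_j=\sum_{i=1}^n c_{ji}\partial_i$, be vector fields on $\mathbb R^n$ that are Lipschitz continuous on an open set $\Omega_0\supset\overline\Omega$. Let $d:\mathbb R^n\times\mathbb R^n\to[0,\infty]$ be the Carnot–Carathéodory distance of $X$: $d(x,y)$ is the infimum of the $T\ge 0$ for which there is an absolutely continuous $\gamma:[0,T]\to\mathbb R^n$ with $\gamma(0)=x$, $\gamma(T)=y$ and $\langle\gamma'(t),\xi\rangle^2\le\sum_j\langle X_j(\gamma(t)),\xi\rangle^2$ for a.e. $t$ and all $\xi\in\mathbb R^n$ (and $d(x,y)=\infty$ if there is none). Write $B_d(x,r)=\{y\in\Omega_0: d(x,y)<r\}$. Assume: * (LIC) there is a Lebesgue-null set $\mathcal N\subset\Omega$, relatively closed in $\Omega$, such that $X_1(x),\dots,X_m(x)$ are linearly independent for every $x\in\Omega\setminus\mathcal N$; * (H1) $d$ is finite on $\Omega_0\times\Omega_0$ and continuous there for the Euclidean topology; * (H2) for every compact $K\subset\Omega_0$ there are $r_K,C_K>0$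 with $|B_d(x,2r)|\le C_K|B_d(x,r)|$ for all $x\in K$ and $0<r<r_K$; * (H3) there are $c,C>0$ such that for every $\bar x$ and $r>0$ with $\{y\in\mathbb R^n: d(\bar x,y)<cr\}\subset\Omega_0$, every $u$ that is Lipschitz on $\overline{B_d(\bar x,cr)}$, and every $x\in\overline{B}$, where $B=B_d(\bar x,r)$, $$\Big|u(x)-\frac1{|B|}\int_B u\,dy\Big|\le C\int_{B_d(\bar x,cr)}|Xu(y)|\,\frac{d(x,y)}{|B_d(x,d(x,y))|}\,dy .$$ Let $W^{1,p}_X(\Omega)$ be the space of $u\in L^p(\Omega)$ whose distributional $X$-gradient $Xu=(X_1u,\dots,X_mu)$, defined by $X_ju(\psi)=-\int_\Omega u\sum_i\partial_i(c_{ji}\psi)\,dx$ for $\psi\in C_c^\infty(\Omega)$, belongs to $L^p(\Omega;\mathbb R^m)$, with the norm $\big(\int_\Omega|u|^p+\int_\Omega|Xu|^p\big)^{1/p}$, and let $W^{1,p}_{X,0}(\Omega)$ be the closure of $C^1_c(\Omega)\cap W^{1,p}_X(\Omega)$ in it. Let $0<c_0\le c_1$, let $a_0,a_1\in L^\infty(\Omega)$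 be nonnegative, and let $f_h$ $(h\in\mathbb N)$ and $f$ be functions $\Omega\times\mathbb R^m\to\mathbb R$, each Borel measurable in $x$ for every $\eta$, convex in $\eta$ for a.e. $x$, and lying between $c_0|\eta|^p-a_0(x)$ and $c_1|\eta|^p+a_1(x)$ for a.e. $x\in\Omega$ and every $\eta\in\mathbb R^m$. Assume that for every $\eta\in\mathbb R^m$, $f_h(x,\eta)\to f(x,\eta)$ for a.e. $x\in\Omega$. Put $$F_h(u)=\int_\Omega f_h(x,Xu(x))\,dx,\qquad F(u)=\int_\Omega f(x,Xu(x))\,dx .$$ A sequence $\Phi_h$ of functionals on a topological space $S$ $\Gamma$-converges to $\Phi$ if, for every $u\in S$, $\sup_U\liminf_h\inf_U\Phi_h=\sup_U\limsup_h\inf_U\Phi_h=\Phi(u)$, where $U$ runs through the neighbourhoods of $u$. **Theorem.** $F_h$ and $F$ are well defined and finite on $W^{1,p}_X(\Omega)$, and: 1. $(F_h)_h$, restricted to $W^{1,p}_{X,0}(\Omega)$, $\Gamma$-converges to $F$ in the weak topology of $W^{1,p}_{X,0}(\Omega)$. 2. If $W^{1,p}_X(\Omega)$ is compactly embedded in $L^p(\Omega)$,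 then, for every Carathéodory function $g:\Omega\times\mathbb R\to\mathbb R$ for which there are constants $0<d_0\le d_1$ and nonnegative $b_0,b_1\in L^1(\Omega)$ with $d_0|s|^p-b_0(x)\le g(x,s)\le d_1|s|^p+b_1(x)$ for a.e. $x\in\Omega$ and every $s\in\mathbb R$, the functional $G(u)=\int_\Omega g(x,u(x))\,dx$ is well defined and finite on $W^{1,p}_X(\Omega)$, and $(F_h+G)_h$ $\Gamma$-converges to $F+G$ in the weak topology of $W^{1,p}_X(\Omega)$. -/

import Mathlib

open MeasureTheory Filter Topology Set
open scoped ENNReal NNReal ContDiff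

/-! ### Families of vector fields

A family `X = (X_1, …, X_m)` of vector fields is a map `X : Fin m → ℝⁿ → ℝⁿ`; the coefficient
`c_{ji}` of `X_j = ∑ i, c_{ji} ∂_i` is `fun x => X j x i`. -/

/-- `X` is Lipschitz continuous on `Ω₀`. -/
def LipschitzFields {n m : ℕ} (X : Fin m → EuclideanSpace ℝ (Fin n) → EuclideanSpace ℝ (Fin n))
    (Ω₀ : Set (EuclideanSpace ℝ (Fin n))) : Prop :=
  ∃ L : ℝ≥0, ∀ j, LipschitzOnWith L (X j) Ω₀

/-- The linear independence condition (LIC) on `Ω`: outside a relatively closed null subset `N` of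
`Ω`, the vectors `X_1(x), …, X_m(x)` are linearly independent. -/
def LIC {n m : ℕ} (X : Fin m → EuclideanSpace ℝ (Fin n) → EuclideanSpace ℝ (Fin n))
    (Ω : Set (EuclideanSpace ℝ (Fin n))) : Prop :=
  ∃ N : Set (EuclideanSpace ℝ (Fin n)), N ⊆ Ω ∧ IsClosed ((↑) ⁻¹' N : Set Ω) ∧ volume N = 0 ∧
    ∀ x ∈ Ω \ N, LinearIndependent ℝ (fun j => X j x)

/-- `γ : [0,T] → ℝⁿ` is a sub-unit curve: it is absolutely continuous and
`⟨γ'(t), ξ⟩² ≤ ∑ j, ⟨X_j(γ(t)), ξ⟩²` for a.e. `t ∈ [0,T]` and every `ξ`. -/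
def IsSubunitCurve {n m : ℕ} (X : Fin m → EuclideanSpace ℝ (Fin n) → EuclideanSpace ℝ (Fin n))
    (T : ℝ) (γ : ℝ → EuclideanSpace ℝ (Fin n)) : Prop :=
  AbsolutelyContinuousOnInterval γ 0 T ∧
    ∀ᵐ t ∂(volume.restrict (Icc 0 T)), ∀ ξ : EuclideanSpace ℝ (Fin n),
      (inner ℝ (deriv γ t) ξ) ^ 2 ≤ ∑ j, (inner ℝ (X j (γ t)) ξ) ^ 2

/-- The Carnot–Carathéodory distance: the infimum of the times `T ≥ 0` such that a sub-unit curve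
`γ : [0,T] → ℝⁿ` joins `x` to `y`, and `∞` if there is none. -/
noncomputable def ccDist {n m : ℕ}
    (X : Fin m → EuclideanSpace ℝ (Fin n) → EuclideanSpace ℝ (Fin n))
    (x y : EuclideanSpace ℝ (Fin n)) : ℝ≥0∞ :=
  sInf {t : ℝ≥0∞ | ∃ (T : ℝ) (γ : ℝ → EuclideanSpace ℝ (Fin n)), 0 ≤ T ∧ t = ENNReal.ofReal T ∧
    IsSubunitCurve X T γ ∧ γ 0 = x ∧ γ T = y}

/-- The metric ball `B_d(x,r) = {y ∈ Ω₀ | d(x,y) < r}`, with an extended radius. -/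
def ccBall {n m : ℕ} (X : Fin m → EuclideanSpace ℝ (Fin n) → EuclideanSpace ℝ (Fin n))
    (Ω₀ : Set (EuclideanSpace ℝ (Fin n))) (x : EuclideanSpace ℝ (Fin n)) (r : ℝ≥0∞) :
    Set (EuclideanSpace ℝ (Fin n)) :=
  {y | y ∈ Ω₀ ∧ ccDist X x y < r}

/-- (H1): `d` is finite on `Ω₀ × Ω₀` and continuous there for the Euclidean topology. -/
def CondH1 {n m : ℕ} (X : Fin m → EuclideanSpace ℝ (Fin n) → EuclideanSpace ℝ (Fin n))
    (Ω₀ : Set (EuclideanSpace ℝ (Fin n))) : Prop :=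
  (∀ x ∈ Ω₀, ∀ y ∈ Ω₀, ccDist X x y < ⊤) ∧
    ContinuousOn
      (fun z : EuclideanSpace ℝ (Fin n) × EuclideanSpace ℝ (Fin n) => ccDist X z.1 z.2) (Ω₀ ×ˢ Ω₀)

/-- (H2): local doubling of Lebesgue measure on metric balls. -/
def CondH2 {n m : ℕ} (X : Fin m → EuclideanSpace ℝ (Fin n) → EuclideanSpace ℝ (Fin n))
    (Ω₀ : Set (EuclideanSpace ℝ (Fin n))) : Prop :=
  ∀ K : Set (EuclideanSpace ℝ (Fin n)), IsCompact K → K ⊆ Ω₀ →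
    ∃ rK > (0 : ℝ), ∃ CK > (0 : ℝ), ∀ x ∈ K, ∀ r : ℝ, 0 < r → r < rK →
      volume (ccBall X Ω₀ x (ENNReal.ofReal (2 * r))) ≤
        ENNReal.ofReal CK * volume (ccBall X Ω₀ x (ENNReal.ofReal r))

/-- The gradient `Xu(y) = (X_1 u(y), …, X_m u(y))` of a function that is differentiable at `y`. -/
noncomputable def pointwiseXGrad {n m : ℕ}
    (X : Fin m → EuclideanSpace ℝ (Fin n) → EuclideanSpace ℝ (Fin n))
    (u : EuclideanSpace ℝ (Fin n) → ℝ) (y : EuclideanSpace ℝ (Fin n)) : EuclideanSpace ℝ (Fin m) :=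
  WithLp.toLp 2 (fun j => fderiv ℝ u y (X j y))

/-- (H3): the representation inequality. The dilated ball is required to lie in `Ω₀` as a ball of
`ℝⁿ`, and a Lipschitz function `u` is differentiable a.e. in that ball, so that `Xu` makes sense
a.e. there. -/
def CondH3 {n m : ℕ} (X : Fin m → EuclideanSpace ℝ (Fin n) → EuclideanSpace ℝ (Fin n))
    (Ω₀ : Set (EuclideanSpace ℝ (Fin n))) : Prop :=
  ∃ c > (0 : ℝ), ∃ C > (0 : ℝ), ∀ (z : EuclideanSpace ℝ (Fin n)) (r : ℝ), 0 < r →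
    {y | ccDist X z y < ENNReal.ofReal (c * r)} ⊆ Ω₀ →
    ∀ u : EuclideanSpace ℝ (Fin n) → ℝ,
      (∃ L : ℝ≥0, LipschitzOnWith L u (closure (ccBall X Ω₀ z (ENNReal.ofReal (c * r))))) →
      ∀ x ∈ closure (ccBall X Ω₀ z (ENNReal.ofReal r)),
        ENNReal.ofReal |u x - ⨍ y in ccBall X Ω₀ z (ENNReal.ofReal r), u y| ≤
          ENNReal.ofReal C * ∫⁻ y in ccBall X Ω₀ z (ENNReal.ofReal (c * r)),
            ‖pointwiseXGrad X u y‖ₑ * (ccDist X x y / volume (ccBall X Ω₀ x (ccDist X x y)))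

/-! ### The Sobolev spaces of the `X`-gradient -/

/-- The formal adjoint `X_jᵀ ψ = - ∑ i, ∂_i (c_{ji} ψ)`. For Lipschitz coefficients the partial
derivatives exist almost everywhere. -/
noncomputable def adjointField {n m : ℕ}
    (X : Fin m → EuclideanSpace ℝ (Fin n) → EuclideanSpace ℝ (Fin n)) (j : Fin m)
    (ψ : EuclideanSpace ℝ (Fin n) → ℝ) (x : EuclideanSpace ℝ (Fin n)) : ℝ :=
  -∑ i, fderiv ℝ (fun y => X j y i * ψ y) x (EuclideanSpace.single i 1)

/-- `v = Xu` in the sense of distributions on `Ω`: `∫_Ω u X_jᵀψ = ∫_Ω v_j ψ` for every `j` and every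
`ψ ∈ C_c^∞(Ω)`. The integrability of `u X_jᵀψ` is automatic when `u` is locally integrable and the
coefficients are Lipschitz on `Ω`; with it, the relation is linear without any assumption on `X`. -/
def IsWeakXGrad {n m : ℕ} (X : Fin m → EuclideanSpace ℝ (Fin n) → EuclideanSpace ℝ (Fin n))
    (Ω : Set (EuclideanSpace ℝ (Fin n))) (u : EuclideanSpace ℝ (Fin n) → ℝ)
    (v : EuclideanSpace ℝ (Fin n) → EuclideanSpace ℝ (Fin m)) : Prop :=
  ∀ (j : Fin m) (ψ : EuclideanSpace ℝ (Fin n) → ℝ),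
    ContDiff ℝ ∞ ψ → HasCompactSupport ψ → tsupport ψ ⊆ Ω →
      IntegrableOn (fun x => u x * adjointField X j ψ x) Ω ∧
      ∫ x in Ω, u x * adjointField X j ψ x = ∫ x in Ω, v x j * ψ x

lemma integrableOn_coord_mul {n m : ℕ} (p : ℝ≥0∞) [hp : Fact (1 ≤ p)]
    (Ω : Set (EuclideanSpace ℝ (Fin n)))
    (v : Lp (EuclideanSpace ℝ (Fin m)) p (volume.restrict Ω)) (j : Fin m)
    {ψ : EuclideanSpace ℝ (Fin n) → ℝ} (hψ : ContDiff ℝ ∞ ψ) (hc : HasCompactSupport ψ) :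
    IntegrableOn (fun x => v x j * ψ x) Ω := by
  have h1 := ((Lp.memLp v).locallyIntegrable hp.out).integrable_smul_left_of_hasCompactSupport
    hψ.continuous hc
  have h2 := (EuclideanSpace.proj (𝕜 := ℝ) j).integrable_comp h1
  refine h2.congr (Eventually.of_forall fun x => ?_)
  simp [mul_comm]

/-- The space `W^{1,p}_X(Ω)`, realised as the space of the pairs `(u, Xu)` with `u ∈ L^p(Ω)` and
`Xu ∈ L^p(Ω; ℝᵐ)`, with the norm `(∫_Ω |u|^p + ∫_Ω |Xu|^p)^{1/p}` inherited from the `ℓ^p`-product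
(for `1 ≤ p < ∞`). The second entry is determined by the first one, see `WX.ext_fn`. -/
noncomputable def WX {n m : ℕ} (p : ℝ≥0∞) [Fact (1 ≤ p)]
    (X : Fin m → EuclideanSpace ℝ (Fin n) → EuclideanSpace ℝ (Fin n))
    (Ω : Set (EuclideanSpace ℝ (Fin n))) :
    Submodule ℝ (WithLp p
      (Lp ℝ p (volume.restrict Ω) × Lp (EuclideanSpace ℝ (Fin m)) p (volume.restrict Ω))) where
  carrier := {w | IsWeakXGrad X Ω w.fst w.snd}
  zero_mem' := by
    intro j ψ _ _ _
    have hu := Lp.coeFn_zero ℝ p (volume.restrict Ω)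
    have hv := Lp.coeFn_zero (EuclideanSpace ℝ (Fin m)) p (volume.restrict Ω)
    have e1 : (fun x => (0 : Lp ℝ p (volume.restrict Ω)) x * adjointField X j ψ x)
        =ᵐ[volume.restrict Ω] fun _ => 0 := by
      filter_upwards [hu] with x hx
      rw [hx, Pi.zero_apply, zero_mul]
    have e2 : (fun x => (0 : Lp (EuclideanSpace ℝ (Fin m)) p (volume.restrict Ω)) x j * ψ x)
        =ᵐ[volume.restrict Ω] fun _ => 0 := by
      filter_upwards [hv] with x hx
      rw [hx, Pi.zero_apply, PiLp.zero_apply, zero_mul]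
    refine ⟨(integrable_zero _ _ _).congr e1.symm, ?_⟩
    exact (integral_congr_ae e1).trans (integral_congr_ae e2).symm
  add_mem' := by
    intro a b ha hb j ψ h1 h2 h3
    obtain ⟨ia, ea⟩ := ha j ψ h1 h2 h3
    obtain ⟨ib, eb⟩ := hb j ψ h1 h2 h3
    have e1 : (fun x => (a + b).fst x * adjointField X j ψ x) =ᵐ[volume.restrict Ω]
        fun x => a.fst x * adjointField X j ψ x + b.fst x * adjointField X j ψ x := by
      filter_upwards [Lp.coeFn_add a.fst b.fst] with x hx
      rw [WithLp.add_fst, hx]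
      simp [add_mul]
    have e2 : (fun x => (a + b).snd x j * ψ x) =ᵐ[volume.restrict Ω]
        fun x => a.snd x j * ψ x + b.snd x j * ψ x := by
      filter_upwards [Lp.coeFn_add a.snd b.snd] with x hx
      rw [WithLp.add_snd, hx]
      simp [add_mul]
    refine ⟨(ia.add ib).congr e1.symm, ?_⟩
    rw [integral_congr_ae e1, integral_congr_ae e2, integral_add ia ib, ea, eb,
      integral_add (integrableOn_coord_mul p Ω a.snd j h1 h2)
        (integrableOn_coord_mul p Ω b.snd j h1 h2)]
  smul_mem' := by
    intro c a ha j ψ h1 h2 h3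
    obtain ⟨ia, ea⟩ := ha j ψ h1 h2 h3
    have e1 : (fun x => (c • a).fst x * adjointField X j ψ x) =ᵐ[volume.restrict Ω]
        fun x => c * (a.fst x * adjointField X j ψ x) := by
      filter_upwards [Lp.coeFn_smul c a.fst] with x hx
      rw [WithLp.smul_fst, hx]
      simp [mul_assoc]
    have e2 : (fun x => (c • a).snd x j * ψ x) =ᵐ[volume.restrict Ω]
        fun x => c * (a.snd x j * ψ x) := by
      filter_upwards [Lp.coeFn_smul c a.snd] with x hx
      rw [WithLp.smul_snd, hx]
      simp [mul_assoc]
    refine ⟨(ia.const_mul c).congr e1.symm, ?_⟩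
    rw [integral_congr_ae e1, integral_congr_ae e2, integral_const_mul, integral_const_mul, ea]

namespace WX

variable {n m : ℕ} {p : ℝ≥0∞} [hp : Fact (1 ≤ p)]
  {X : Fin m → EuclideanSpace ℝ (Fin n) → EuclideanSpace ℝ (Fin n)}
  {Ω : Set (EuclideanSpace ℝ (Fin n))}

/-- The function `u ∈ L^p(Ω)` underlying an element of `W^{1,p}_X(Ω)`. -/
noncomputable def fn (w : WX p X Ω) : Lp ℝ p (volume.restrict Ω) := w.1.fst

/-- The gradient `Xu ∈ L^p(Ω; ℝᵐ)` of an element of `W^{1,p}_X(Ω)`. -/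
noncomputable def grad (w : WX p X Ω) :
    Lp (EuclideanSpace ℝ (Fin m)) p (volume.restrict Ω) := w.1.snd

/-- An element of `W^{1,p}_X(Ω)` is determined by its underlying `L^p` function. -/
theorem ext_fn (hΩ : IsOpen Ω) {w₁ w₂ : WX p X Ω} (h : WX.fn w₁ = WX.fn w₂) :
    w₁ = w₂ := by
  have key : WX.grad w₁ = WX.grad w₂ := by
    apply Lp.ext
    have hj : ∀ j : Fin m, ∀ᵐ x, x ∈ Ω → WX.grad w₁ x j - WX.grad w₂ x j = 0 := by
      intro j
      have hloc : ∀ w : WX p X Ω, LocallyIntegrableOn (fun x => WX.grad w x j) Ω := by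
        intro w
        have h1 : LocallyIntegrable (fun x => WX.grad w x j) (volume.restrict Ω) := by
          intro x
          obtain ⟨s, hs, hi⟩ := ((Lp.memLp (WX.grad w)).locallyIntegrable hp.out) x
          exact ⟨s, hs, (EuclideanSpace.proj (𝕜 := ℝ) j).integrable_comp hi⟩
        exact locallyIntegrableOn_of_locallyIntegrable_restrict h1
      refine hΩ.ae_eq_zero_of_integral_contDiff_smul_eq_zero ((hloc w₁).sub (hloc w₂)) ?_
      intro ψ h1 h2 h3
      have a1 := (w₁.2 j ψ h1 h2 h3).2
      have a2 := (w₂.2 j ψ h1 h2 h3).2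
      have i1 := integrableOn_coord_mul p Ω (WX.grad w₁) j h1 h2
      have i2 := integrableOn_coord_mul p Ω (WX.grad w₂) j h1 h2
      have hf : w₁.1.fst = w₂.1.fst := h
      rw [hf] at a1
      have e : ∫ x in Ω, (WX.grad w₁ x j * ψ x - WX.grad w₂ x j * ψ x) = 0 := by
        rw [integral_sub i1 i2]
        have := a1.symm.trans a2
        exact sub_eq_zero.2 this
      rw [← setIntegral_eq_integral_of_forall_compl_eq_zero (s := Ω), ← e]
      · refine integral_congr_ae (Eventually.of_forall fun x => ?_)
        simp only [smul_eq_mul]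
        ring
      · intro x hx
        have : ψ x = 0 := image_eq_zero_of_notMem_tsupport fun hx' => hx (h3 hx')
        simp [this]
    have hall : ∀ᵐ x ∂(volume.restrict Ω), ∀ j, WX.grad w₁ x j - WX.grad w₂ x j = 0 :=
      ae_all_iff.2 fun j => (ae_restrict_iff' hΩ.measurableSet).2 (hj j)
    filter_upwards [hall] with x hx
    ext j
    exact sub_eq_zero.1 (hx j)
  apply Subtype.ext
  apply WithLp.ofLp_injective
  exact Prod.ext h key

end WX

/-- The elements of `W^{1,p}_X(Ω)` whose underlying function belongs to `C^1_c(Ω)` (a function of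
`C^1_c(Ω)` being extended by zero to `ℝⁿ`). -/
noncomputable def WXC1c {n m : ℕ} (p : ℝ≥0∞) [Fact (1 ≤ p)]
    (X : Fin m → EuclideanSpace ℝ (Fin n) → EuclideanSpace ℝ (Fin n))
    (Ω : Set (EuclideanSpace ℝ (Fin n))) : Submodule ℝ (WX p X Ω) where
  carrier := {w | ∃ φ : EuclideanSpace ℝ (Fin n) → ℝ, ContDiff ℝ 1 φ ∧ HasCompactSupport φ ∧
    tsupport φ ⊆ Ω ∧ WX.fn w =ᵐ[volume.restrict Ω] φ}
  zero_mem' := by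
    refine ⟨0, contDiff_const, HasCompactSupport.zero, by simp, ?_⟩
    exact Lp.coeFn_zero ℝ p (volume.restrict Ω)
  add_mem' := by
    rintro a b ⟨φ, h1, h2, h3, h4⟩ ⟨χ, k1, k2, k3, k4⟩
    refine ⟨φ + χ, h1.add k1, h2.add k2, (tsupport_add φ χ).trans (union_subset h3 k3), ?_⟩
    exact (Lp.coeFn_add (WX.fn a) (WX.fn b)).trans (h4.add k4)
  smul_mem' := by
    rintro c a ⟨φ, h1, h2, h3, h4⟩
    refine ⟨c • φ, h1.const_smul c, h2.smul_left, (closure_mono ?_).trans h3, ?_⟩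
    · intro x hx hx'
      exact hx (by simp [hx'])
    · exact (Lp.coeFn_smul c (WX.fn a)).trans (h4.const_smul c)

/-- `W^{1,p}_{X,0}(Ω)`: the closure of `C^1_c(Ω) ∩ W^{1,p}_X(Ω)` in `W^{1,p}_X(Ω)`. -/
noncomputable def WX0 {n m : ℕ} (p : ℝ≥0∞) [Fact (1 ≤ p)]
    (X : Fin m → EuclideanSpace ℝ (Fin n) → EuclideanSpace ℝ (Fin n))
    (Ω : Set (EuclideanSpace ℝ (Fin n))) : Submodule ℝ (WX p X Ω) :=
  (WXC1c p X Ω).topologicalClosure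

/-- `W^{1,p}_X(Ω)` is compactly embedded in `L^p(Ω)`. -/
def CompactlyEmbedded {n m : ℕ} (p : ℝ≥0∞) [Fact (1 ≤ p)]
    (X : Fin m → EuclideanSpace ℝ (Fin n) → EuclideanSpace ℝ (Fin n))
    (Ω : Set (EuclideanSpace ℝ (Fin n))) : Prop :=
  IsCompactOperator (fun w : WX p X Ω => WX.fn w)

/-! ### Integrands and functionals -/

/-- The class `I_{m,p}(Ω, c₀, c₁, a₀, a₁)` of integrands. -/
structure IntegrandClass {n m : ℕ} (p : ℝ≥0∞) (Ω : Set (EuclideanSpace ℝ (Fin n))) (c₀ c₁ : ℝ)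
    (a₀ a₁ : EuclideanSpace ℝ (Fin n) → ℝ)
    (f : EuclideanSpace ℝ (Fin n) → EuclideanSpace ℝ (Fin m) → ℝ) : Prop where
  pos : 0 < c₀
  le : c₀ ≤ c₁
  integrable₀ : IntegrableOn a₀ Ω
  integrable₁ : IntegrableOn a₁ Ω
  nonneg₀ : ∀ᵐ x ∂(volume.restrict Ω), 0 ≤ a₀ x
  nonneg₁ : ∀ᵐ x ∂(volume.restrict Ω), 0 ≤ a₁ x
  measurable : ∀ η, Measurable (fun x : Ω => f x η)
  convex : ∀ᵐ x ∂(volume.restrict Ω), ConvexOn ℝ univ (f x)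
  growth : ∀ᵐ x ∂(volume.restrict Ω), ∀ η,
    c₀ * ‖η‖ ^ p.toReal - a₀ x ≤ f x η ∧ f x η ≤ c₁ * ‖η‖ ^ p.toReal + a₁ x

/-- `g : Ω × ℝ → ℝ` is a Carathéodory function. -/
def IsCaratheodory {n : ℕ} (Ω : Set (EuclideanSpace ℝ (Fin n)))
    (g : EuclideanSpace ℝ (Fin n) → ℝ → ℝ) : Prop :=
  (∀ s, AEMeasurable (fun x => g x s) (volume.restrict Ω)) ∧
    ∀ᵐ x ∂(volume.restrict Ω), Continuous (g x)

/-- The growth condition `d₀ |s|^p - b₀(x) ≤ g(x,s) ≤ d₁ |s|^p + b₁(x)` with nonnegative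
`b₀, b₁ ∈ L¹(Ω)`. -/
structure HasGrowth {n : ℕ} (p : ℝ≥0∞) (Ω : Set (EuclideanSpace ℝ (Fin n))) (d₀ d₁ : ℝ)
    (b₀ b₁ : EuclideanSpace ℝ (Fin n) → ℝ) (g : EuclideanSpace ℝ (Fin n) → ℝ → ℝ) : Prop where
  integrable₀ : IntegrableOn b₀ Ω
  integrable₁ : IntegrableOn b₁ Ω
  nonneg₀ : ∀ᵐ x ∂(volume.restrict Ω), 0 ≤ b₀ x
  nonneg₁ : ∀ᵐ x ∂(volume.restrict Ω), 0 ≤ b₁ x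
  growth : ∀ᵐ x ∂(volume.restrict Ω), ∀ s : ℝ,
    d₀ * |s| ^ p.toReal - b₀ x ≤ g x s ∧ g x s ≤ d₁ * |s| ^ p.toReal + b₁ x

/-- `F(u) = ∫_Ω f(x, Xu(x)) dx` on `W^{1,p}_X(Ω)`. -/
noncomputable def gradFunctional {n m : ℕ} {p : ℝ≥0∞} [Fact (1 ≤ p)]
    {X : Fin m → EuclideanSpace ℝ (Fin n) → EuclideanSpace ℝ (Fin n)}
    {Ω : Set (EuclideanSpace ℝ (Fin n))}
    (f : EuclideanSpace ℝ (Fin n) → EuclideanSpace ℝ (Fin m) → ℝ) (u : WX p X Ω) : ℝ :=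
  ∫ x in Ω, f x (WX.grad u x)

/-- `G(u) = ∫_Ω g(x, u(x)) dx` on `W^{1,p}_X(Ω)`. -/
noncomputable def datumFunctional {n m : ℕ} {p : ℝ≥0∞} [Fact (1 ≤ p)]
    {X : Fin m → EuclideanSpace ℝ (Fin n) → EuclideanSpace ℝ (Fin n)}
    {Ω : Set (EuclideanSpace ℝ (Fin n))}
    (g : EuclideanSpace ℝ (Fin n) → ℝ → ℝ) (u : WX p X Ω) : ℝ :=
  ∫ x in Ω, g x (WX.fn u x)

/-! ### Γ-convergence in a topological space -/

/-- `Γ-liminf F_h (x) = sup_{U ∈ 𝓝 x} liminf_h inf_U F_h`. -/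
noncomputable def gammaLiminf {S : Type*} [TopologicalSpace S] (F : ℕ → S → EReal) (x : S) :
    EReal :=
  ⨆ U ∈ 𝓝 x, liminf (fun h => ⨅ y ∈ U, F h y) atTop

/-- `Γ-limsup F_h (x) = sup_{U ∈ 𝓝 x} limsup_h inf_U F_h`. -/
noncomputable def gammaLimsup {S : Type*} [TopologicalSpace S] (F : ℕ → S → EReal) (x : S) :
    EReal :=
  ⨆ U ∈ 𝓝 x, limsup (fun h => ⨅ y ∈ U, F h y) atTop

/-- `(F_h)` Γ-converges to `F` in the topological space `S`. -/
def GammaConverges {S : Type*} [TopologicalSpace S] (F : ℕ → S → EReal) (F₀ : S → EReal) : Prop :=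
  ∀ x, gammaLiminf F x = F₀ x ∧ gammaLimsup F x = F₀ x

/-- Γ-convergence of real-valued functionals on a normed space `E` in the weak topology of `E`. -/
def WeaklyGammaConverges {E : Type*} [NormedAddCommGroup E] [NormedSpace ℝ E]
    (F : ℕ → E → ℝ) (F₀ : E → ℝ) : Prop :=
  GammaConverges (S := WeakSpace ℝ E)
    (fun h u => ((F h ((toWeakSpace ℝ E).symm u) : ℝ) : EReal))
    (fun u => ((F₀ ((toWeakSpace ℝ E).symm u) : ℝ) : EReal))

/-!
The argument takes place in `L^p(Ω; ℝᵐ)`, into which `u ↦ Xu` is a bounded operator, hence weakly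
continuous. The recovery sequence at `u` is the constant one: `F_h(u) → F(u)` by dominated
convergence.

For the Γ-liminf inequality, `tiltInf φ a = inf_η (φ η - ⟪a, η⟫)` denotes minus the convex conjugate.
The integrands have growth of order `p > 1` with uniform constants, so they are equi-Lipschitz on
balls and their minimisation may be confined to a ball; hence `f_h(x, ·) → f(x, ·)` pointwise implies
`tiltInf (f_h x) a → tiltInf (f x) a` for every `a` (`IsConvexWithGrowth.tendsto_tiltInf`). As
`f(x, η)` is the supremum of `⟪a, η⟫ + tiltInf (f x) a` over a countable dense set of `a`
(`IsConvexWithGrowth.exists_lt_inner_add_tiltInf`), a measurable selection among finitely many `a`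
gives a bounded `ξ` for which `∫ ⟪ξ, Xu⟫ + ∫ tiltInf (f x) (ξ x)` is as close to `F(u)` as desired.
By Young's inequality, `F_h(w) ≥ ∫ ⟪ξ, Xw⟫ + ∫ tiltInf (f_h x) (ξ x)` for every `w`; the first term is
weakly continuous in `w`, and the second one converges as `h → ∞` by dominated convergence
(`IsConvexIntegrand.exists_affine_minorants`). So `F_h` is bounded below by nearly `F(u)` on a fixed
weak neighbourhood of `u` (`IsConvexIntegrand.exists_weak_nhds`).

The term `G` is lower semicontinuous on `L^p` by Fatou's lemma. The compact embedding is weak-to-norm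
continuous on bounded sets (`IsCompactOperator.exists_weak_nhds`), and outside a large ball the
coercivity of `F_h + G` makes the lower bound trivial
(`IsConvexIntegrand.weaklyGammaConverges_add`).
-/

/-! ### Convex functions with superlinear growth -/

/-- `φ` is convex and lies between `c₀ ‖η‖ ^ p - A` and `c₁ ‖η‖ ^ p + B`. -/
structure IsConvexWithGrowth {E : Type*} [NormedAddCommGroup E] [NormedSpace ℝ E]
    (p c₀ c₁ A B : ℝ) (φ : E → ℝ) : Prop where
  convexOn : ConvexOn ℝ univ φ
  lower : ∀ η, c₀ * ‖η‖ ^ p - A ≤ φ η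
  upper : ∀ η, φ η ≤ c₁ * ‖η‖ ^ p + B

/-- The infimum of `η ↦ φ η - ⟪a, η⟫`, that is, minus the convex conjugate of `φ` at `a`. The infimum
is taken over a countable dense set, which is harmless for continuous `φ` and makes it measurable
with respect to parameters. -/
noncomputable def tiltInf {E : Type*} [NormedAddCommGroup E] [InnerProductSpace ℝ E]
    [TopologicalSpace.SeparableSpace E] (φ : E → ℝ) (a : E) : ℝ :=
  ⨅ i : ℕ, (φ (TopologicalSpace.denseSeq E i) - inner ℝ a (TopologicalSpace.denseSeq E i))

lemma exists_le_mul_rpow_sub_mul {p c : ℝ} (hp : 1 < p) (hc : 0 < c) (b M : ℝ) :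
    ∃ R, ∀ t, R ≤ t → M ≤ c * t ^ p - b * t := by
  have h1 : Tendsto (fun t : ℝ => t * (c * t ^ (p - 1) + -b)) atTop atTop :=
    tendsto_id.atTop_mul_atTop₀ (tendsto_atTop_add_const_right _ _
      ((tendsto_rpow_atTop (by linarith)).const_mul_atTop hc))
  obtain ⟨R, hR⟩ := eventually_atTop.1 ((h1.eventually_ge_atTop M).and (eventually_gt_atTop 0))
  refine ⟨R, fun t ht => (hR t ht).1.trans_eq ?_⟩
  rw [Real.rpow_sub_one (hR t ht).2.ne']
  have := (hR t ht).2.ne'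
  field_simp
  ring

lemma exists_neg_le_mul_rpow_sub_mul {p c : ℝ} (hp : 1 < p) (hc : 0 < c) (b : ℝ) :
    ∃ C, ∀ t, 0 ≤ t → -C ≤ c * t ^ p - b * t := by
  obtain ⟨R, hR⟩ := exists_le_mul_rpow_sub_mul hp hc b 0
  refine ⟨|b| * |R|, fun t ht => ?_⟩
  rcases le_total R t with h | h
  · exact le_trans (by have := mul_nonneg (abs_nonneg b) (abs_nonneg R); linarith) (hR t h)
  · have h1 : b * t ≤ |b| * |R| :=
      mul_le_mul (le_abs_self b) (h.trans (le_abs_self R)) ht (abs_nonneg b)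
    have h2 : 0 ≤ c * t ^ p := by positivity
    linarith

namespace IsConvexWithGrowth

variable {E : Type*} [NormedAddCommGroup E] {p c₀ c₁ A B : ℝ}

lemma continuous [NormedSpace ℝ E] [FiniteDimensional ℝ E] {φ : E → ℝ}
    (h : IsConvexWithGrowth p c₀ c₁ A B φ) : Continuous φ :=
  continuousOn_univ.1 (h.convexOn.continuousOn isOpen_univ)

/-- The Lipschitz constant on a ball depends on the growth constants only. -/
lemma exists_lipschitzOnWith [NormedSpace ℝ E] (hp : 0 ≤ p) (hc₀ : 0 ≤ c₀) (hc₁ : 0 ≤ c₁)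
    (A B : ℝ) (R : ℝ) :
    ∃ L : ℝ≥0, ∀ φ : E → ℝ, IsConvexWithGrowth p c₀ c₁ A B φ →
      LipschitzOnWith L φ (Metric.closedBall 0 R) := by
  refine ⟨(2 * (c₁ * (|R| + 2) ^ p + |A| + |B|) / 1).toNNReal, fun φ h => ?_⟩
  have hb : ∀ η, dist η 0 < R + 2 → |φ η| ≤ c₁ * (|R| + 2) ^ p + |A| + |B| := by
    intro η hη
    rw [dist_zero_right] at hη
    have h1 : ‖η‖ ^ p ≤ (|R| + 2) ^ p :=
      Real.rpow_le_rpow (norm_nonneg _) (by linarith [le_abs_self R]) hp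
    have h2 := mul_le_mul_of_nonneg_left h1 hc₁
    have h3 : 0 ≤ c₀ * ‖η‖ ^ p := by positivity
    have h4 : 0 ≤ c₁ * (|R| + 2) ^ p := by positivity
    rw [abs_le]
    constructor
    · linarith [h.lower η, le_abs_self A, abs_nonneg B]
    · linarith [h.upper η, le_abs_self B, abs_nonneg A]
  refine ((h.convexOn.subset (subset_univ _) (convex_ball _ _)).lipschitzOnWith_of_abs_le
    one_pos hb).mono ?_
  exact Metric.closedBall_subset_ball (by linarith)

/-- Equi-Lipschitz continuity on balls turns convergence on a dense set into pointwise convergence. -/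
lemma tendsto_of_denseRange [NormedSpace ℝ E] {φ : ℕ → E → ℝ} {φ₀ : E → ℝ} (hp : 0 ≤ p)
    (hc₀ : 0 ≤ c₀) (hc₁ : 0 ≤ c₁)
    (h : ∀ k, IsConvexWithGrowth p c₀ c₁ A B (φ k)) (h₀ : IsConvexWithGrowth p c₀ c₁ A B φ₀)
    {e : ℕ → E} (he : DenseRange e)
    (hlim : ∀ i, Tendsto (fun k => φ k (e i)) atTop (𝓝 (φ₀ (e i)))) (η : E) :
    Tendsto (fun k => φ k η) atTop (𝓝 (φ₀ η)) := by
  obtain ⟨L, hL⟩ := exists_lipschitzOnWith (E := E) hp hc₀ hc₁ A B (‖η‖ + 1)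
  rw [Metric.tendsto_atTop]
  intro ε hε
  obtain ⟨i, hi⟩ := he.exists_dist_lt η (ε := min 1 (ε / (3 * (L + 1)))) (by positivity)
  obtain ⟨N, hN⟩ := Metric.tendsto_atTop.1 (hlim i) (ε / 3) (by positivity)
  refine ⟨N, fun k hk => ?_⟩
  have hηm : η ∈ Metric.closedBall (0 : E) (‖η‖ + 1) := by simp
  have him : e i ∈ Metric.closedBall (0 : E) (‖η‖ + 1) := by
    rw [mem_closedBall_zero_iff]
    have := norm_le_norm_add_norm_sub' (e i) η
    rw [← dist_eq_norm, dist_comm] at this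
    linarith [hi.trans_le (min_le_left _ _)]
  have hd : L * dist η (e i) ≤ ε / 3 := by
    have h1 := hi.le.trans (min_le_right _ _)
    calc (L : ℝ) * dist η (e i) ≤ (L + 1) * (ε / (3 * (L + 1))) := by gcongr; linarith
      _ = ε / 3 := by field_simp
  have h1 := (hL _ (h k)).dist_le_mul _ hηm _ him
  have h2 := (hL _ h₀).dist_le_mul _ hηm _ him
  have h3 := hN k hk
  have h4 := dist_triangle4 (φ k η) (φ k (e i)) (φ₀ (e i)) (φ₀ η)
  rw [dist_comm (φ₀ (e i))] at h4
  linarith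

variable [InnerProductSpace ℝ E]

/-- Tilting by a vector of norm at most `b` keeps a lower bound that depends on `b` only. -/
lemma lower_tilt {φ : E → ℝ} (h : IsConvexWithGrowth p c₀ c₁ A B φ) {a : E} {b : ℝ}
    (ha : ‖a‖ ≤ b) (η : E) : c₀ * ‖η‖ ^ p - b * ‖η‖ - A ≤ φ η - inner ℝ a η := by
  have h1 := h.lower η
  have h2 : inner ℝ a η ≤ b * ‖η‖ :=
    (real_inner_le_norm a η).trans (mul_le_mul_of_nonneg_right ha (norm_nonneg _))
  linarith

lemma le_tiltInf [TopologicalSpace.SeparableSpace E] {φ : E → ℝ} {a : E} {t : ℝ}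
    (h : ∀ η, t ≤ φ η - inner ℝ a η) : t ≤ tiltInf φ a :=
  le_ciInf fun _ => h _

variable [FiniteDimensional ℝ E]

/-- Young's inequality for `φ` and its conjugate. -/
lemma tiltInf_le {φ : E → ℝ} (h : IsConvexWithGrowth p c₀ c₁ A B φ) (hp : 1 < p) (hc : 0 < c₀)
    (a η : E) : tiltInf φ a ≤ φ η - inner ℝ a η := by
  obtain ⟨C, hC⟩ := exists_neg_le_mul_rpow_sub_mul hp hc ‖a‖
  have hbdd : BddBelow (range fun i : ℕ => φ (TopologicalSpace.denseSeq E i)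
      - inner ℝ a (TopologicalSpace.denseSeq E i)) := by
    refine ⟨-C - A, ?_⟩
    rintro _ ⟨i, rfl⟩
    have := h.lower_tilt le_rfl (TopologicalSpace.denseSeq E i) (a := a)
    have := hC _ (norm_nonneg (TopologicalSpace.denseSeq E i))
    linarith
  have hcl : IsClosed {ζ : E | tiltInf φ a ≤ φ ζ - inner ℝ a ζ} :=
    isClosed_le continuous_const (h.continuous.sub (continuous_const.inner continuous_id))
  have hd := (TopologicalSpace.denseRange_denseSeq E).closure_range
  have : closure (range (TopologicalSpace.denseSeq E)) ⊆
      {ζ : E | tiltInf φ a ≤ φ ζ - inner ℝ a ζ} := by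
    refine closure_minimal ?_ hcl
    rintro _ ⟨i, rfl⟩
    exact ciInf_le hbdd i
  exact this (hd ▸ mem_univ η)

lemma exists_abs_tiltInf_le (hp : 1 < p) (hc : 0 < c₀) (c₁ : ℝ) (b : ℝ) :
    ∃ C, ∀ (A B : ℝ) (φ : E → ℝ) (a : E), 0 ≤ A → 0 ≤ B → IsConvexWithGrowth p c₀ c₁ A B φ →
      ‖a‖ ≤ b → |tiltInf φ a| ≤ C + A + B := by
  obtain ⟨C, hC⟩ := exists_neg_le_mul_rpow_sub_mul hp hc b
  refine ⟨|C|, fun A B φ a hA hB h ha => abs_le.2 ⟨?_, ?_⟩⟩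
  · refine le_tiltInf fun η => ?_
    linarith [h.lower_tilt ha η, hC _ (norm_nonneg η), le_abs_self C]
  · have h1 := h.tiltInf_le hp hc a 0
    have h2 := h.upper 0
    rw [norm_zero, Real.zero_rpow (by linarith)] at h2
    rw [inner_zero_right] at h1
    linarith [abs_nonneg C]

/-- A convex function with superlinear growth is the supremum of the affine functions
`η ↦ ⟪a, η⟫ + tiltInf φ a` with `a` in a dense set. -/
lemma exists_lt_inner_add_tiltInf {φ : E → ℝ} (h : IsConvexWithGrowth p c₀ c₁ A B φ) (hp : 1 < p)
    (hc : 0 < c₀) {a : ℕ → E} (ha : DenseRange a) {η : E} {t : ℝ} (ht : t < φ η) :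
    ∃ k, t < inner ℝ (a k) η + tiltInf φ (a k) := by
  obtain ⟨s, hts, hs⟩ := exists_between ht
  obtain ⟨l, c, hl, hlη⟩ := h.convexOn.exists_affine_le_of_lt (𝕜 := ℝ) (mem_univ η) hs isClosed_univ
    (h.continuous.lowerSemicontinuous.lowerSemicontinuousOn _)
  set b : E := (InnerProductSpace.toDual ℝ E).symm l with hb
  have hbl : ∀ ζ, inner ℝ b ζ = l ζ := fun ζ => by
    rw [hb, InnerProductSpace.toDual_symm_apply]
  have hle : ∀ ζ, inner ℝ b ζ + c ≤ φ ζ := fun ζ => by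
    rw [hbl]; exact hl ⟨ζ, mem_univ ζ⟩
  have heq : inner ℝ b η + c = s := by rw [hbl]; exact hlη
  -- Outside the ball of radius `R`, every tilt by a vector close to `b` is large.
  obtain ⟨R, hR⟩ := exists_le_mul_rpow_sub_mul hp hc (‖b‖ + 1) (s + (‖b‖ + 1) * ‖η‖ + A)
  set δ := min 1 ((s - t) / (|R| + ‖η‖ + 1)) with hδ
  have hδ0 : 0 < δ := lt_min one_pos (div_pos (by linarith) (by positivity))
  obtain ⟨k, hk⟩ := ha.exists_dist_lt b hδ0
  refine ⟨k, ?_⟩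
  have hk' : ‖a k - b‖ ≤ δ := by rw [← dist_eq_norm, dist_comm]; exact hk.le
  have hkb : ‖a k‖ ≤ ‖b‖ + 1 := by
    have := norm_le_norm_add_norm_sub' (a k) b
    linarith [min_le_left 1 ((s - t) / (|R| + ‖η‖ + 1))]
  have hη : |inner ℝ (a k - b) η| ≤ δ * ‖η‖ :=
    (abs_real_inner_le_norm _ _).trans (mul_le_mul_of_nonneg_right hk' (norm_nonneg _))
  have hηb : |inner ℝ (a k) η| ≤ (‖b‖ + 1) * ‖η‖ :=
    (abs_real_inner_le_norm _ _).trans (mul_le_mul_of_nonneg_right hkb (norm_nonneg _))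
  have hδR : δ * (|R| + ‖η‖) < s - t := by
    have h1 : δ * (|R| + ‖η‖ + 1) ≤ s - t := by
      have := mul_le_mul_of_nonneg_right (min_le_right 1 ((s - t) / (|R| + ‖η‖ + 1)))
        (show 0 ≤ |R| + ‖η‖ + 1 by positivity)
      rwa [div_mul_cancel₀ _ (by positivity)] at this
    linarith
  suffices hmain : s - inner ℝ (a k) η - δ * (|R| + ‖η‖) ≤ tiltInf φ (a k) by linarith
  refine le_tiltInf fun ζ => ?_
  rcases le_total R ‖ζ‖ with hζ | hζ
  · have h1 := hR _ hζ
    have h2 := h.lower_tilt hkb ζ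
    have h3 : 0 ≤ δ * (|R| + ‖η‖) := by positivity
    linarith [(abs_le.1 hηb).1]
  · have h1 : |inner ℝ (a k - b) ζ| ≤ δ * |R| :=
      (abs_real_inner_le_norm _ _).trans
        (mul_le_mul hk' (hζ.trans (le_abs_self R)) (norm_nonneg _) hδ0.le)
    have h2 := hle ζ
    rw [inner_sub_left] at h1 hη
    linarith [(abs_le.1 h1).2, (abs_le.1 hη).1]

/-- Pointwise convergence of equicoercive convex functions passes to their conjugates. -/
lemma tendsto_tiltInf {φ : ℕ → E → ℝ} {φ₀ : E → ℝ} (hp : 1 < p) (hc₀ : 0 < c₀) (hc₁ : 0 ≤ c₁)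
    (h : ∀ k, IsConvexWithGrowth p c₀ c₁ A B (φ k)) (h₀ : IsConvexWithGrowth p c₀ c₁ A B φ₀)
    (hlim : ∀ η, Tendsto (fun k => φ k η) atTop (𝓝 (φ₀ η))) (a : E) :
    Tendsto (fun k => tiltInf (φ k) a) atTop (𝓝 (tiltInf φ₀ a)) := by
  rw [tendsto_order]
  constructor
  · intro t ht
    obtain ⟨R, hR⟩ := exists_le_mul_rpow_sub_mul hp hc₀ ‖a‖ (tiltInf φ₀ a + A)
    obtain ⟨L, hL⟩ := exists_lipschitzOnWith (E := E) (zero_le_one.trans hp.le) hc₀.le hc₁ A B R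
    set ε := (tiltInf φ₀ a - t) / 3 with hε
    have hε0 : 0 < ε := div_pos (by linarith) (by norm_num)
    have hδ : 0 < ε / (L + ‖a‖ + 1) := by positivity
    obtain ⟨S, hS, hSf, hcov⟩ := (isCompact_closedBall (0 : E) R).finite_cover_balls hδ
    have hev : ∀ᶠ k in atTop, ∀ y ∈ S, φ₀ y - ε < φ k y :=
      (eventually_all_finite hSf).2 fun y _ =>
        (hlim y).eventually_const_lt (by linarith)
    filter_upwards [hev] with k hk
    suffices hmain : tiltInf φ₀ a - 2 * ε ≤ tiltInf (φ k) a by linarith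
    refine le_tiltInf fun ζ => ?_
    rcases le_total R ‖ζ‖ with hζ | hζ
    · linarith [hR _ hζ, (h k).lower_tilt le_rfl ζ (a := a)]
    · have hζm : ζ ∈ Metric.closedBall (0 : E) R := by simpa using hζ
      obtain ⟨y, hy, hζy⟩ := mem_iUnion₂.1 (hcov hζm)
      have hd : dist ζ y ≤ ε / (L + ‖a‖ + 1) := (Metric.mem_ball.1 hζy).le
      have h1 := (hL _ (h k)).dist_le_mul _ hζm _ (hS hy)
      have h2 := hk y hy
      have h3 := h₀.tiltInf_le hp hc₀ a y
      have h4 := (abs_real_inner_le_norm a (ζ - y))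
      rw [← dist_eq_norm, inner_sub_right] at h4
      have h5 : (L + ‖a‖) * dist ζ y ≤ ε := by
        calc (L + ‖a‖) * dist ζ y ≤ (L + ‖a‖ + 1) * (ε / (L + ‖a‖ + 1)) :=
              mul_le_mul (by linarith) hd dist_nonneg (by positivity)
          _ = ε := by field_simp
      rw [Real.dist_eq] at h1
      linarith [(abs_le.1 h1).1, (abs_le.1 h4).2]
  · intro t ht
    obtain ⟨i, hi⟩ := exists_lt_of_ciInf_lt ht
    filter_upwards [((hlim _).sub_const _).eventually_lt_const hi] with k hk
    exact ((h k).tiltInf_le hp hc₀ a _).trans_lt hk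

end IsConvexWithGrowth

/-! ### Integrals of convex integrands -/

lemma ENNReal.one_lt_toReal {p : ℝ≥0∞} (hp₁ : 1 < p) (hp₂ : p ≠ ⊤) : 1 < p.toReal :=
  (ENNReal.toReal_lt_toReal ENNReal.one_ne_top hp₂).2 hp₁

/-- Superposition with a Carathéodory function preserves measurability. -/
lemma AEMeasurable.caratheodory_comp {α β : Type*} [MeasurableSpace α] {μ : Measure α}
    [TopologicalSpace β] {f : α → β → ℝ} (hf : ∀ s, AEMeasurable (fun x => f x s) μ)
    (hc : ∀ᵐ x ∂μ, Continuous (f x)) {v : α → β} (hv : AEStronglyMeasurable v μ) :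
    AEMeasurable (fun x => f x (v x)) μ := by
  set w := hv.mk v
  have hw : StronglyMeasurable w := hv.stronglyMeasurable_mk
  have hsimple : ∀ k, AEMeasurable (fun x => f x (hw.approx k x)) μ := by
    intro k
    have hfin := (hw.approx k).finite_range
    have h1 : ∀ x, f x (hw.approx k x) =
        ∑ s ∈ (hw.approx k).range, ((hw.approx k) ⁻¹' {s}).indicator (fun x => f x s) x := by
      intro x
      rw [Finset.sum_eq_single (hw.approx k x)]
      · simp
      · intro s _ hs
        exact indicator_of_notMem (fun h => hs h.symm) _
      · intro h
        exact absurd ((hw.approx k).mem_range_self x) h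
    simp_rw [h1]
    exact Finset.aemeasurable_fun_sum _ fun s _ =>
      (hf s).indicator ((hw.approx k).measurableSet_fiber s)
  refine aemeasurable_of_tendsto_metrizable_ae atTop hsimple ?_
  filter_upwards [hc, hv.ae_eq_mk] with x hx hvx
  rw [hvx]
  exact (hx.tendsto (w x)).comp (hw.tendsto_approx x)

/-- A measurable choice, for each `N`, of an index that maximises `q 0 x, …, q N x`. -/
lemma exists_measurable_argmax {α : Type*} [MeasurableSpace α] {μ : Measure α} {q : α → ℕ → ℝ}
    (hq : ∀ k, AEMeasurable (fun x => q x k) μ) :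
    ∃ κ : ℕ → α → ℕ, (∀ N, Measurable (κ N)) ∧ (∀ N x, κ N x ≤ N) ∧
      ∀ᵐ x ∂μ, ∀ N, ∀ j ≤ N, q x j ≤ q x (κ N x) := by
  set r : α → ℕ → ℝ := fun x k => (hq k).mk _ x with hr
  have hrm : ∀ k, Measurable fun x => r x k := fun k => (hq k).measurable_mk
  have hrc : ∀ k : α → ℕ, Measurable k → Measurable fun x => r x (k x) := fun k hk =>
    (measurable_from_prod_countable_left (f := fun z : α × ℕ => r z.1 z.2) hrm).comp
      (measurable_id.prodMk hk)
  set κ : ℕ → α → ℕ := fun N => Nat.rec (fun _ => 0)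
    (fun N k x => if r x (k x) < r x (N + 1) then N + 1 else k x) N with hκ
  have hsucc : ∀ N x, κ (N + 1) x = if r x (κ N x) < r x (N + 1) then N + 1 else κ N x :=
    fun _ _ => rfl
  refine ⟨κ, ?_, ?_, ?_⟩
  · intro N
    induction N with
    | zero => exact measurable_const
    | succ N ih => exact Measurable.ite (measurableSet_lt (hrc _ ih) (hrm _)) measurable_const ih
  · intro N x
    induction N with
    | zero => exact le_rfl
    | succ N ih =>
      rw [hsucc]
      split_ifs <;> omega
  · have hall : ∀ᵐ x ∂μ, ∀ k, q x k = r x k := ae_all_iff.2 fun k => (hq k).ae_eq_mk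
    filter_upwards [hall] with x hx N
    induction N with
    | zero =>
      intro j hj
      obtain rfl : j = 0 := by omega
      exact le_rfl
    | succ N ih =>
      intro j hj
      rw [hsucc]
      rcases Nat.le_succ_iff.1 hj with hj | rfl <;> split_ifs with h
      · exact (ih j hj).trans (by rw [hx, hx]; exact h.le)
      · exact ih j hj
      · exact le_rfl
      · rw [hx, hx]; exact not_lt.1 h

/-- `f` is an integrand on `α × E` that is measurable in `x`, and convex with growth of order `p`
in `η`. -/
structure IsConvexIntegrand {α E : Type*} [MeasurableSpace α] [NormedAddCommGroup E]
    [NormedSpace ℝ E] (μ : Measure α) (p : ℝ≥0∞) (c₀ c₁ : ℝ) (a₀ a₁ : α → ℝ) (f : α → E → ℝ) :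
    Prop where
  aemeasurable : ∀ η, AEMeasurable (fun x => f x η) μ
  growth : ∀ᵐ x ∂μ, IsConvexWithGrowth p.toReal c₀ c₁ (a₀ x) (a₁ x) (f x)

namespace IsConvexIntegrand

variable {α E : Type*} [MeasurableSpace α] [NormedAddCommGroup E] {μ : Measure α}
  {p : ℝ≥0∞} {c₀ c₁ : ℝ} {a₀ a₁ : α → ℝ}

/-- The functional is coercive. -/
lemma le_integral [NormedSpace ℝ E] {f : α → E → ℝ}
    (h : IsConvexIntegrand μ p c₀ c₁ a₀ a₁ f) (hp₁ : 1 < p) (hp₂ : p ≠ ⊤)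
    (ha₀ : Integrable a₀ μ) {v : α → E} (hv : MemLp v p μ)
    (hi : Integrable (fun x => f x (v x)) μ) :
    c₀ * ∫ x, ‖v x‖ ^ p.toReal ∂μ - ∫ x, a₀ x ∂μ ≤ ∫ x, f x (v x) ∂μ := by
  have h1 := (hv.integrable_norm_rpow (by positivity) hp₂).const_mul c₀
  rw [← integral_const_mul, ← integral_sub h1 ha₀]
  refine integral_mono_ae (h1.sub ha₀) hi ?_
  filter_upwards [h.growth] with x hx
  exact hx.lower _

variable [NormedSpace ℝ E]

lemma ae_abs_le {f : α → E → ℝ} (h : IsConvexIntegrand μ p c₀ c₁ a₀ a₁ f) (hc₀ : 0 ≤ c₀)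
    (hc₁ : 0 ≤ c₁) (ha₀ : ∀ᵐ x ∂μ, 0 ≤ a₀ x) (ha₁ : ∀ᵐ x ∂μ, 0 ≤ a₁ x) (v : α → E) :
    ∀ᵐ x ∂μ, ‖f x (v x)‖ ≤ c₁ * ‖v x‖ ^ p.toReal + a₀ x + a₁ x := by
  filter_upwards [h.growth, ha₀, ha₁] with x hx h0 h1
  have h2 := hx.lower (v x)
  have h3 := hx.upper (v x)
  have h4 : 0 ≤ c₀ * ‖v x‖ ^ p.toReal := by positivity
  have h5 : 0 ≤ c₁ * ‖v x‖ ^ p.toReal := by positivity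
  rw [Real.norm_eq_abs, abs_le]
  constructor <;> linarith

variable [FiniteDimensional ℝ E]

lemma integrable_comp {f : α → E → ℝ} (h : IsConvexIntegrand μ p c₀ c₁ a₀ a₁ f) (hp₁ : 1 < p)
    (hp₂ : p ≠ ⊤) (hc₀ : 0 ≤ c₀) (hc₁ : 0 ≤ c₁) (ha₀ : ∀ᵐ x ∂μ, 0 ≤ a₀ x)
    (ha₁ : ∀ᵐ x ∂μ, 0 ≤ a₁ x) (hi₀ : Integrable a₀ μ) (hi₁ : Integrable a₁ μ) {v : α → E}
    (hv : MemLp v p μ) : Integrable (fun x => f x (v x)) μ := by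
  have h1 := (hv.integrable_norm_rpow (by positivity) hp₂).const_mul c₁
  refine ((h1.add hi₀).add hi₁).mono' ?_ (h.ae_abs_le hc₀ hc₁ ha₀ ha₁ v)
  refine (AEMeasurable.caratheodory_comp h.aemeasurable ?_ hv.1).aestronglyMeasurable
  filter_upwards [h.growth] with x hx using hx.continuous

lemma ae_tendsto {f : ℕ → α → E → ℝ} {f₀ : α → E → ℝ}
    (h : ∀ k, IsConvexIntegrand μ p c₀ c₁ a₀ a₁ (f k))
    (h₀ : IsConvexIntegrand μ p c₀ c₁ a₀ a₁ f₀) (hc₀ : 0 ≤ c₀) (hc₁ : 0 ≤ c₁)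
    (hlim : ∀ η, ∀ᵐ x ∂μ, Tendsto (fun k => f k x η) atTop (𝓝 (f₀ x η))) :
    ∀ᵐ x ∂μ, ∀ η, Tendsto (fun k => f k x η) atTop (𝓝 (f₀ x η)) := by
  have h1 : ∀ᵐ x ∂μ, ∀ k, IsConvexWithGrowth p.toReal c₀ c₁ (a₀ x) (a₁ x) (f k x) :=
    ae_all_iff.2 fun k => (h k).growth
  have h2 : ∀ᵐ x ∂μ, ∀ i, Tendsto (fun k => f k x (TopologicalSpace.denseSeq E i)) atTop
      (𝓝 (f₀ x (TopologicalSpace.denseSeq E i))) := ae_all_iff.2 fun i => hlim _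
  filter_upwards [h1, h2, h₀.growth] with x hx1 hx2 hx3
  exact IsConvexWithGrowth.tendsto_of_denseRange ENNReal.toReal_nonneg hc₀ hc₁ hx1 hx3
    (TopologicalSpace.denseRange_denseSeq E) hx2

lemma tendsto_integral {f : ℕ → α → E → ℝ} {f₀ : α → E → ℝ}
    (h : ∀ k, IsConvexIntegrand μ p c₀ c₁ a₀ a₁ (f k))
    (h₀ : IsConvexIntegrand μ p c₀ c₁ a₀ a₁ f₀) (hp₁ : 1 < p) (hp₂ : p ≠ ⊤) (hc₀ : 0 ≤ c₀)
    (hc₁ : 0 ≤ c₁) (ha₀ : ∀ᵐ x ∂μ, 0 ≤ a₀ x) (ha₁ : ∀ᵐ x ∂μ, 0 ≤ a₁ x)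
    (hi₀ : Integrable a₀ μ) (hi₁ : Integrable a₁ μ)
    (hlim : ∀ η, ∀ᵐ x ∂μ, Tendsto (fun k => f k x η) atTop (𝓝 (f₀ x η)))
    {v : α → E} (hv : MemLp v p μ) :
    Tendsto (fun k => ∫ x, f k x (v x) ∂μ) atTop (𝓝 (∫ x, f₀ x (v x) ∂μ)) := by
  have h1 := (hv.integrable_norm_rpow (by positivity) hp₂).const_mul c₁
  refine tendsto_integral_of_dominated_convergence _
    (fun k => ((h k).integrable_comp hp₁ hp₂ hc₀ hc₁ ha₀ ha₁ hi₀ hi₁ hv).1)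
    ((h1.add hi₀).add hi₁) (fun k => (h k).ae_abs_le hc₀ hc₁ ha₀ ha₁ v) ?_
  filter_upwards [ae_tendsto h h₀ hc₀ hc₁ hlim] with x hx using hx _

end IsConvexIntegrand

lemma integrable_inner_of_bounded {α E : Type*} [MeasurableSpace α] [NormedAddCommGroup E]
    [InnerProductSpace ℝ E] {μ : Measure α} {ξ w : α → E} (hξ : AEStronglyMeasurable ξ μ) {C : ℝ}
    (hC : ∀ x, ‖ξ x‖ ≤ C) (hw : Integrable w μ) : Integrable (fun x => inner ℝ (ξ x) (w x)) μ := by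
  refine (hw.norm.const_mul C).mono' (hξ.inner hw.1) (Eventually.of_forall fun x => ?_)
  exact (norm_inner_le_norm _ _).trans (mul_le_mul_of_nonneg_right (hC x) (norm_nonneg _))

section Minorant

variable {α E : Type*} [MeasurableSpace α] [NormedAddCommGroup E] [InnerProductSpace ℝ E]
  [FiniteDimensional ℝ E] {μ : Measure α} {p : ℝ≥0∞} {c₀ c₁ : ℝ} {a₀ a₁ : α → ℝ}

lemma IsConvexIntegrand.aemeasurable_tiltInf {f : α → E → ℝ}
    (h : IsConvexIntegrand μ p c₀ c₁ a₀ a₁ f) (a : E) :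
    AEMeasurable (fun x => tiltInf (f x) a) μ :=
  AEMeasurable.iInf fun _ => (h.aemeasurable _).sub_const _

/-- Below each value of the limit functional passes a family of affine minorants of the approximating
functionals, all with the same bounded slope `ξ`. The slope takes finitely many values `a k`,
and at almost every `x` it is chosen to make `⟪a k, v x⟫ + tiltInf (f₀ x) (a k)` nearly equal to
`f₀ x (v x)`. -/
theorem IsConvexIntegrand.exists_affine_minorants [IsFiniteMeasure μ] {f : ℕ → α → E → ℝ}
    {f₀ : α → E → ℝ} (h : ∀ k, IsConvexIntegrand μ p c₀ c₁ a₀ a₁ (f k))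
    (h₀ : IsConvexIntegrand μ p c₀ c₁ a₀ a₁ f₀) (hp₁ : 1 < p) (hp₂ : p ≠ ⊤) (hc₀ : 0 < c₀)
    (hc₁ : 0 ≤ c₁) (ha₀ : ∀ᵐ x ∂μ, 0 ≤ a₀ x) (ha₁ : ∀ᵐ x ∂μ, 0 ≤ a₁ x)
    (hi₀ : Integrable a₀ μ) (hi₁ : Integrable a₁ μ)
    (hlim : ∀ η, ∀ᵐ x ∂μ, Tendsto (fun k => f k x η) atTop (𝓝 (f₀ x η)))
    {v : α → E} (hv : MemLp v p μ) {t : ℝ} (ht : t < ∫ x, f₀ x (v x) ∂μ) :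
    ∃ (ξ : α → E) (c : ℕ → ℝ) (c' : ℝ), MemLp ξ ⊤ μ ∧ Tendsto c atTop (𝓝 c') ∧
      t < ∫ x, inner ℝ (ξ x) (v x) ∂μ + c' ∧
      ∀ k, ∀ w : α → E, MemLp w p μ →
        ∫ x, inner ℝ (ξ x) (w x) ∂μ + c k ≤ ∫ x, f k x (w x) ∂μ := by
  have hp : 1 < p.toReal := ENNReal.one_lt_toReal hp₁ hp₂
  set a : ℕ → E := TopologicalSpace.denseSeq E with ha
  have had : DenseRange a := TopologicalSpace.denseRange_denseSeq E
  have hint : ∀ {w : α → E}, MemLp w p μ → Integrable w μ := fun hw => hw.integrable hp₁.le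
  set q : α → ℕ → ℝ := fun x k => inner ℝ (a k) (v x) + tiltInf (f₀ x) (a k) with hq
  have hqm : ∀ k, AEMeasurable (fun x => q x k) μ := fun k =>
    (hv.1.const_inner (c := a k)).aemeasurable.add (h₀.aemeasurable_tiltInf (a k))
  obtain ⟨κ, hκm, hκN, hκ⟩ := exists_measurable_argmax hqm
  have hξm : ∀ N, Measurable[_, borel E] fun x => a (κ N x) := fun N => by
    borelize E
    exact (measurable_from_nat (f := a)).comp (hκm N)
  have hξs : ∀ N, StronglyMeasurable fun x => a (κ N x) := fun N => by
    borelize E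
    exact (hξm N).stronglyMeasurable
  have hξb : ∀ N, ∀ x, ‖a (κ N x)‖ ≤ ∑ k ∈ Finset.range (N + 1), ‖a k‖ := fun N x =>
    Finset.single_le_sum (f := fun k => ‖a k‖) (fun _ _ => norm_nonneg _)
      (Finset.mem_range.2 (Nat.lt_succ_of_le (hκN N x)))
  choose C hC using fun N : ℕ => IsConvexWithGrowth.exists_abs_tiltInf_le (E := E) hp hc₀ c₁
    (∑ k ∈ Finset.range (N + 1), ‖a k‖)
  have hmm : ∀ {g : α → E → ℝ}, IsConvexIntegrand μ p c₀ c₁ a₀ a₁ g → ∀ N,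
      AEStronglyMeasurable (fun x => tiltInf (g x) (a (κ N x))) μ := fun {g} hg N =>
    (AEMeasurable.caratheodory_comp (f := fun x k => tiltInf (g x) (a k))
      (fun k => hg.aemeasurable_tiltInf (a k))
      (Eventually.of_forall fun _ => continuous_of_discreteTopology)
      (hκm N).stronglyMeasurable.aestronglyMeasurable).aestronglyMeasurable
  have hmb : ∀ {g : α → E → ℝ}, IsConvexIntegrand μ p c₀ c₁ a₀ a₁ g → ∀ N,
      ∀ᵐ x ∂μ, ‖tiltInf (g x) (a (κ N x))‖ ≤ C N + a₀ x + a₁ x := fun hg N => by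
    filter_upwards [hg.growth, ha₀, ha₁] with x hx h0 h1
    exact hC N _ _ _ _ h0 h1 hx (hξb N x)
  have hbi : ∀ N, Integrable (fun x => C N + a₀ x + a₁ x) μ := fun N =>
    ((integrable_const _).add hi₀).add hi₁
  have hmi : ∀ {g : α → E → ℝ}, IsConvexIntegrand μ p c₀ c₁ a₀ a₁ g → ∀ N,
      Integrable (fun x => tiltInf (g x) (a (κ N x))) μ := fun hg N =>
    (hbi N).mono' (hmm hg N) (hmb hg N)
  have hii : ∀ N, ∀ {w : α → E}, MemLp w p μ →
      Integrable (fun x => inner ℝ (a (κ N x)) (w x)) μ := fun N _ hw =>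
    integrable_inner_of_bounded (hξs N).aestronglyMeasurable (hξb N) (hint hw)
  have hfi : ∀ {g : α → E → ℝ}, IsConvexIntegrand μ p c₀ c₁ a₀ a₁ g → ∀ {w : α → E},
      MemLp w p μ → Integrable (fun x => g x (w x)) μ := fun {_} hg {_} hw =>
    hg.integrable_comp hp₁ hp₂ hc₀.le hc₁ ha₀ ha₁ hi₀ hi₁ hw
  have hqle : ∀ᵐ x ∂μ, ∀ k, q x k ≤ f₀ x (v x) := by
    filter_upwards [h₀.growth] with x hx k
    have := hx.tiltInf_le hp hc₀ (a k) (v x)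
    simp only [hq]
    linarith
  -- As `N → ∞`, the maximum of `q x 0, …, q x N` increases to `f₀ x (v x)`.
  have hN : Tendsto (fun N => ∫ x, q x (κ N x) ∂μ) atTop (𝓝 (∫ x, f₀ x (v x) ∂μ)) := by
    refine tendsto_integral_of_dominated_convergence
      (fun x => |f₀ x (v x)| + |q x (κ 0 x)|)
      (fun N => ((hii N hv).add (hmi h₀ N)).1)
      ((hfi h₀ hv).abs.add ((hii 0 hv).add (hmi h₀ 0)).abs) (fun N => ?_) ?_
    · filter_upwards [hqle, hκ] with x hx1 hx2
      have h1 := hx2 N (κ 0 x) ((hκN 0 x).trans (Nat.zero_le N))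
      rw [Real.norm_eq_abs, abs_le]
      constructor
      · linarith [neg_abs_le (q x (κ 0 x)), abs_nonneg (f₀ x (v x))]
      · linarith [hx1 (κ N x), le_abs_self (f₀ x (v x)), abs_nonneg (q x (κ 0 x))]
    · filter_upwards [hqle, hκ, h₀.growth] with x hx1 hx2 hx3
      refine tendsto_order.2 ⟨fun s hs => ?_, fun s hs => ?_⟩
      · obtain ⟨k, hk⟩ := hx3.exists_lt_inner_add_tiltInf hp hc₀ had hs
        filter_upwards [eventually_ge_atTop k] with N hN
        exact hk.trans_le (hx2 N k hN)
      · exact Eventually.of_forall fun N => (hx1 _).trans_lt hs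
  obtain ⟨N, hNt⟩ := (hN.eventually_const_lt ht).exists
  refine ⟨fun x => a (κ N x), fun k => ∫ x, tiltInf (f k x) (a (κ N x)) ∂μ,
    ∫ x, tiltInf (f₀ x) (a (κ N x)) ∂μ, ?_, ?_, ?_, ?_⟩
  · exact memLp_top_of_bound (hξs N).aestronglyMeasurable _ (Eventually.of_forall (hξb N))
  · refine tendsto_integral_of_dominated_convergence _ (fun k => hmm (h k) N) (hbi N)
      (fun k => hmb (h k) N) ?_
    have h1 : ∀ᵐ x ∂μ, ∀ k, IsConvexWithGrowth p.toReal c₀ c₁ (a₀ x) (a₁ x) (f k x) :=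
      ae_all_iff.2 fun k => (h k).growth
    filter_upwards [h1, h₀.growth, IsConvexIntegrand.ae_tendsto h h₀ hc₀.le hc₁ hlim]
      with x hx1 hx2 hx3
    exact IsConvexWithGrowth.tendsto_tiltInf hp hc₀ hc₁ hx1 hx2 hx3 _
  · rw [← integral_add (hii N hv) (hmi h₀ N)]
    exact hNt
  · intro k w hw
    rw [← integral_add (hii N hw) (hmi (h k) N)]
    refine integral_mono_ae ((hii N hw).add (hmi (h k) N)) (hfi (h k) hw) ?_
    filter_upwards [(h k).growth] with x hx
    have := hx.tiltInf_le hp hc₀ (a (κ N x)) (w x)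
    linarith

end Minorant

/-! ### Γ-convergence and weak neighbourhoods -/

/-- If constant sequences are recovery sequences, Γ-convergence is a local lower bound that is
uniform in the index. -/
lemma gammaConverges_of_tendsto {S : Type*} [TopologicalSpace S] {F : ℕ → S → ℝ} {F₀ : S → ℝ}
    (hsup : ∀ x, Tendsto (fun h => F h x) atTop (𝓝 (F₀ x)))
    (hinf : ∀ x, ∀ t < F₀ x, ∃ U ∈ 𝓝 x, ∀ᶠ h in atTop, ∀ y ∈ U, t ≤ F h y) :
    GammaConverges (fun h x => (F h x : EReal)) (fun x => (F₀ x : EReal)) := by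
  intro x
  have h1 : gammaLimsup (fun h x => (F h x : EReal)) x ≤ F₀ x := by
    refine iSup₂_le fun U hU => ?_
    have hlim : Tendsto (fun h => (F h x : EReal)) atTop (𝓝 (F₀ x : EReal)) :=
      (continuous_coe_real_ereal.tendsto _).comp (hsup x)
    rw [← hlim.limsup_eq]
    exact limsup_le_limsup (Eventually.of_forall fun h => iInf₂_le x (mem_of_mem_nhds hU))
  have h2 : gammaLiminf (fun h x => (F h x : EReal)) x
      ≤ gammaLimsup (fun h x => (F h x : EReal)) x :=
    iSup₂_mono fun U _ => liminf_le_limsup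
  have h3 : (F₀ x : EReal) ≤ gammaLiminf (fun h x => (F h x : EReal)) x := by
    refine EReal.ge_of_forall_gt_iff_ge.1 fun t ht => ?_
    obtain ⟨U, hU, hev⟩ := hinf x t (EReal.coe_lt_coe_iff.1 ht)
    refine le_trans ?_ (le_iSup₂ (f := fun U (_ : U ∈ 𝓝 x) =>
      liminf (fun h => ⨅ y ∈ U, (F h y : EReal)) atTop) U hU)
    refine le_liminf_of_le ⟨⊤, fun _ _ => le_top⟩ ?_
    filter_upwards [hev] with h hh
    exact le_iInf₂ fun y hy => EReal.coe_le_coe_iff.2 (hh y hy)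
  exact ⟨le_antisymm (h2.trans h1) h3, le_antisymm h1 (h3.trans h2)⟩

/-- The criterion `gammaConverges_of_tendsto` in the weak topology of a normed space. -/
lemma weaklyGammaConverges_of_tendsto {V : Type*} [NormedAddCommGroup V] [NormedSpace ℝ V]
    {F : ℕ → V → ℝ} {F₀ : V → ℝ} (hsup : ∀ u, Tendsto (fun h => F h u) atTop (𝓝 (F₀ u)))
    (hinf : ∀ u, ∀ t < F₀ u, ∃ U ∈ 𝓝 (toWeakSpace ℝ V u), ∀ᶠ h in atTop,
      ∀ y, toWeakSpace ℝ V y ∈ U → t ≤ F h y) :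
    WeaklyGammaConverges F F₀ := by
  refine gammaConverges_of_tendsto (fun u => hsup _) fun u t ht => ?_
  obtain ⟨U, hU, hev⟩ := hinf ((toWeakSpace ℝ V).symm u) t ht
  refine ⟨U, by simpa using hU, ?_⟩
  filter_upwards [hev] with h hh y hy
  exact hh _ (by simpa using hy)

/-- A compact operator is weak-to-norm continuous on bounded sets. -/
lemma IsCompactOperator.exists_weak_nhds {V W : Type*} [NormedAddCommGroup V] [NormedSpace ℝ V]
    [NormedAddCommGroup W] [NormedSpace ℝ W] {T : V →L[ℝ] W} (hT : IsCompactOperator T) (R : ℝ)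
    (u : V) {N : Set W} (hN : N ∈ 𝓝 (T u)) :
    ∃ U ∈ 𝓝 (toWeakSpace ℝ V u), ∀ y, toWeakSpace ℝ V y ∈ U → ‖y‖ ≤ R → T y ∈ N := by
  obtain ⟨K, hK, hTK⟩ := IsCompactOperator.image_closedBall_subset_compact
    (f := T.toLinearMap) hT R
  -- On the compact set `K \ interior N`, the norm and the weak topology coincide.
  have hc : IsClosed (toWeakSpaceCLM ℝ W '' (K \ interior N)) :=
    ((hK.diff isOpen_interior).image (toWeakSpaceCLM ℝ W).continuous).isClosed
  refine ⟨WeakSpace.map T ⁻¹' (toWeakSpaceCLM ℝ W '' (K \ interior N))ᶜ,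
    (hc.isOpen_compl.preimage (WeakSpace.map T).continuous).mem_nhds ?_, fun y hy hyR => ?_⟩
  · rintro ⟨z, hz, hzu⟩
    have : z = T u := toWeakSpaceCLM_bijective.1 hzu
    exact hz.2 (this ▸ mem_interior_iff_mem_nhds.2 hN)
  · by_contra hyN
    exact hy ⟨T y, ⟨hTK ⟨y, by simpa using hyR, rfl⟩, fun h => hyN (interior_subset h)⟩, rfl⟩

/-! ### Lower semicontinuity of the lower-order term -/

/-- Fatou's lemma along a subsequence converging almost everywhere. -/
lemma eventually_lt_integral_caratheodory_comp {α : Type*} [MeasurableSpace α] {μ : Measure α}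
    {p : ℝ≥0∞} [Fact (1 ≤ p)] {g : α → ℝ → ℝ} {b : α → ℝ} (hc : ∀ᵐ x ∂μ, Continuous (g x))
    (hb : Integrable b μ) (hgb : ∀ᵐ x ∂μ, ∀ s, -b x ≤ g x s)
    (hi : ∀ w : Lp ℝ p μ, Integrable (fun x => g x (w x)) μ) (u : Lp ℝ p μ) {t : ℝ}
    (ht : t < ∫ x, g x (u x) ∂μ) : ∀ᶠ w in 𝓝 u, t < ∫ x, g x (w x) ∂μ := by
  by_contra hcon
  obtain ⟨w, hw, hwt⟩ := exists_seq_forall_of_frequently (not_eventually.1 hcon)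
  obtain ⟨ns, hns, hae⟩ := (tendstoInMeasure_of_tendsto_Lp hw).exists_seq_tendsto_ae
  have hpos : ∀ v : Lp ℝ p μ, 0 ≤ᵐ[μ] fun x => g x (v x) + b x := fun v => by
    filter_upwards [hgb] with x hx
    have := hx (v x)
    simp only [Pi.zero_apply]
    linarith
  have hlint : ∀ v : Lp ℝ p μ, ∫⁻ x, ENNReal.ofReal (g x (v x) + b x) ∂μ
      = ENNReal.ofReal (∫ x, g x (v x) ∂μ + ∫ x, b x ∂μ) := fun v => by
    rw [← integral_add (hi v) hb]
    exact (ofReal_integral_eq_lintegral_ofReal ((hi v).add hb) (hpos v)).symm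
  have h1 : ∫⁻ x, ENNReal.ofReal (g x (u x) + b x) ∂μ
      ≤ ENNReal.ofReal (t + ∫ x, b x ∂μ) := by
    calc ∫⁻ x, ENNReal.ofReal (g x (u x) + b x) ∂μ
        = ∫⁻ x, liminf (fun k => ENNReal.ofReal (g x (w (ns k) x) + b x)) atTop ∂μ := by
          refine lintegral_congr_ae ?_
          filter_upwards [hae, hc] with x hx hcx
          exact (((ENNReal.continuous_ofReal.tendsto _).comp
            (((hcx.tendsto _).comp hx).add_const (b x))).liminf_eq).symm
      _ ≤ liminf (fun k => ∫⁻ x, ENNReal.ofReal (g x (w (ns k) x) + b x) ∂μ) atTop :=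
          lintegral_liminf_le' fun k => ((hi _).add hb).1.aemeasurable.ennreal_ofReal
      _ ≤ liminf (fun _ : ℕ => ENNReal.ofReal (t + ∫ x, b x ∂μ)) atTop := by
          refine liminf_le_liminf (Eventually.of_forall fun k => ?_)
          rw [hlint]
          exact ENNReal.ofReal_le_ofReal (by linarith [not_lt.1 (hwt (ns k))])
      _ = _ := liminf_const _
  have h0 : 0 ≤ t + ∫ x, b x ∂μ := by
    have h2 := integral_nonneg_of_ae (hpos (w 0))
    rw [integral_add (hi _) hb] at h2
    linarith [not_lt.1 (hwt 0)]
  rw [hlint, ENNReal.ofReal_le_ofReal_iff h0] at h1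
  linarith

/-! ### Γ-convergence of integrals along a bounded operator into `L^p` -/

lemma MeasureTheory.Lp.norm_rpow_eq_integral {α E : Type*} [MeasurableSpace α] [NormedAddCommGroup E]
    {μ : Measure α} {p : ℝ≥0∞} (hp₀ : p ≠ 0) (hp : p ≠ ⊤) (v : Lp E p μ) :
    ‖v‖ ^ p.toReal = ∫ x, ‖v x‖ ^ p.toReal ∂μ := by
  have h0 : 0 ≤ ∫ x, ‖v x‖ ^ p.toReal ∂μ := integral_nonneg fun x => by positivity
  rw [Lp.norm_def, (Lp.memLp v).eLpNorm_eq_integral_rpow_norm hp₀ hp,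
    ENNReal.toReal_ofReal (by positivity), ← Real.rpow_mul h0,
    inv_mul_cancel₀ (ENNReal.toReal_pos hp₀ hp).ne', Real.rpow_one]

section BoundedOperator

variable {α E V : Type*} [MeasurableSpace α] [NormedAddCommGroup E] [InnerProductSpace ℝ E]
  [FiniteDimensional ℝ E] [NormedAddCommGroup V] [NormedSpace ℝ V] {μ : Measure α}
  [IsFiniteMeasure μ] {p : ℝ≥0∞} [Fact (1 ≤ p)] {c₀ c₁ : ℝ} {a₀ a₁ : α → ℝ}
  {f : ℕ → α → E → ℝ} {f₀ : α → E → ℝ}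

/-- The Γ-liminf inequality for integrals of convex integrands, along a bounded operator into `L^p`:
the affine minorants have weakly continuous linear parts. -/
lemma IsConvexIntegrand.exists_weak_nhds
    (h : ∀ k, IsConvexIntegrand μ p c₀ c₁ a₀ a₁ (f k))
    (h₀ : IsConvexIntegrand μ p c₀ c₁ a₀ a₁ f₀) (hp₁ : 1 < p) (hp₂ : p ≠ ⊤) (hc₀ : 0 < c₀)
    (hc₁ : 0 ≤ c₁) (ha₀ : ∀ᵐ x ∂μ, 0 ≤ a₀ x) (ha₁ : ∀ᵐ x ∂μ, 0 ≤ a₁ x)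
    (hi₀ : Integrable a₀ μ) (hi₁ : Integrable a₁ μ)
    (hlim : ∀ η, ∀ᵐ x ∂μ, Tendsto (fun k => f k x η) atTop (𝓝 (f₀ x η)))
    (T : V →L[ℝ] Lp E p μ) (u : V) {t : ℝ} (ht : t < ∫ x, f₀ x (T u x) ∂μ) :
    ∃ U ∈ 𝓝 (toWeakSpace ℝ V u), ∀ᶠ k in atTop, ∀ y, toWeakSpace ℝ V y ∈ U →
      t ≤ ∫ x, f k x (T y x) ∂μ := by
  obtain ⟨ξ, c, c', hξ, hc, htc, hle⟩ := IsConvexIntegrand.exists_affine_minorants h h₀ hp₁ hp₂ hc₀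
    hc₁ ha₀ ha₁ hi₀ hi₁ hlim (Lp.memLp (T u)) ht
  have hξq : MemLp ξ (ENNReal.conjExponent p) μ := hξ.mono_exponent le_top
  have hq : Fact (1 ≤ ENNReal.conjExponent p) := ⟨ENNReal.HolderConjugate.one_le _ p⟩
  set B : E →L[ℝ] E →L[ℝ] ℝ := innerSL ℝ
  set l : Lp E p μ →L[ℝ] ℝ :=
    B.lpPairing μ (ENNReal.conjExponent p) p (hξq.toLp ξ)
  have hl : ∀ w, l w = ∫ x, inner ℝ (ξ x) (w x) ∂μ := by
    intro w
    refine (B.lpPairing_eq_integral _ _).trans (integral_congr_ae ?_)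
    filter_upwards [hξq.coeFn_toLp] with x hx
    rw [hx]
    exact innerSL_apply_apply ℝ _ _
  have hcont : Continuous fun y : WeakSpace ℝ V => l (T ((toWeakSpace ℝ V).symm y)) :=
    WeakBilin.eval_continuous (topDualPairing ℝ V).flip (l.comp T)
  rw [← hl] at htc
  set δ := (l (T u) + c' - t) / 2 with hδ
  have hδ0 : 0 < δ := by linarith
  refine ⟨{y | l (T u) - δ < l (T ((toWeakSpace ℝ V).symm y))},
    (isOpen_lt continuous_const hcont).mem_nhds (by simpa using hδ0), ?_⟩
  filter_upwards [hc.eventually_const_lt (sub_lt_self c' hδ0)] with k hk y hy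
  have h1 := hle k _ (Lp.memLp (T y))
  rw [← hl] at h1
  have h2 : l (T u) - δ < l (T y) := hy
  linarith

theorem IsConvexIntegrand.weaklyGammaConverges
    (h : ∀ k, IsConvexIntegrand μ p c₀ c₁ a₀ a₁ (f k))
    (h₀ : IsConvexIntegrand μ p c₀ c₁ a₀ a₁ f₀) (hp₁ : 1 < p) (hp₂ : p ≠ ⊤) (hc₀ : 0 < c₀)
    (hc₁ : 0 ≤ c₁) (ha₀ : ∀ᵐ x ∂μ, 0 ≤ a₀ x) (ha₁ : ∀ᵐ x ∂μ, 0 ≤ a₁ x)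
    (hi₀ : Integrable a₀ μ) (hi₁ : Integrable a₁ μ)
    (hlim : ∀ η, ∀ᵐ x ∂μ, Tendsto (fun k => f k x η) atTop (𝓝 (f₀ x η)))
    (T : V →L[ℝ] Lp E p μ) :
    WeaklyGammaConverges (fun k u => ∫ x, f k x (T u x) ∂μ) (fun u => ∫ x, f₀ x (T u x) ∂μ) :=
  weaklyGammaConverges_of_tendsto
    (fun u => tendsto_integral h h₀ hp₁ hp₂ hc₀.le hc₁ ha₀ ha₁ hi₀ hi₁ hlim (Lp.memLp (T u)))
    fun u _ ht => exists_weak_nhds h h₀ hp₁ hp₂ hc₀ hc₁ ha₀ ha₁ hi₀ hi₁ hlim T u ht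

theorem IsConvexIntegrand.weaklyGammaConverges_submodule
    (h : ∀ k, IsConvexIntegrand μ p c₀ c₁ a₀ a₁ (f k))
    (h₀ : IsConvexIntegrand μ p c₀ c₁ a₀ a₁ f₀) (hp₁ : 1 < p) (hp₂ : p ≠ ⊤) (hc₀ : 0 < c₀)
    (hc₁ : 0 ≤ c₁) (ha₀ : ∀ᵐ x ∂μ, 0 ≤ a₀ x) (ha₁ : ∀ᵐ x ∂μ, 0 ≤ a₁ x)
    (hi₀ : Integrable a₀ μ) (hi₁ : Integrable a₁ μ)
    (hlim : ∀ η, ∀ᵐ x ∂μ, Tendsto (fun k => f k x η) atTop (𝓝 (f₀ x η)))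
    (T : V →L[ℝ] Lp E p μ) (Z : Submodule ℝ V) :
    WeaklyGammaConverges (E := Z) (fun k u => ∫ x, f k x (T u x) ∂μ)
      (fun u => ∫ x, f₀ x (T u x) ∂μ) :=
  weaklyGammaConverges h h₀ hp₁ hp₂ hc₀ hc₁ ha₀ ha₁ hi₀ hi₁ hlim (T.comp Z.subtypeL)

/-- Coercivity confines the Γ-liminf inequality to a ball, on which the compact operator `S` makes
the lower-order term weakly lower semicontinuous. -/
theorem IsConvexIntegrand.weaklyGammaConverges_add
    (h : ∀ k, IsConvexIntegrand μ p c₀ c₁ a₀ a₁ (f k))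
    (h₀ : IsConvexIntegrand μ p c₀ c₁ a₀ a₁ f₀) (hp₁ : 1 < p) (hp₂ : p ≠ ⊤) (hc₀ : 0 < c₀)
    (hc₁ : 0 ≤ c₁) (ha₀ : ∀ᵐ x ∂μ, 0 ≤ a₀ x) (ha₁ : ∀ᵐ x ∂μ, 0 ≤ a₁ x)
    (hi₀ : Integrable a₀ μ) (hi₁ : Integrable a₁ μ)
    (hlim : ∀ η, ∀ᵐ x ∂μ, Tendsto (fun k => f k x η) atTop (𝓝 (f₀ x η)))
    (T : V →L[ℝ] Lp E p μ) {S : V →L[ℝ] Lp ℝ p μ} (hS : IsCompactOperator S)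
    (hnorm : ∀ u, ‖u‖ ^ p.toReal = ‖S u‖ ^ p.toReal + ‖T u‖ ^ p.toReal)
    {g : α → ℝ → ℝ} {b₀ : α → ℝ} {d₀ : ℝ} (hd₀ : 0 < d₀) (hgc : ∀ᵐ x ∂μ, Continuous (g x))
    (hb₀ : Integrable b₀ μ) (hg : ∀ᵐ x ∂μ, ∀ s, d₀ * |s| ^ p.toReal - b₀ x ≤ g x s)
    (hgi : ∀ w : Lp ℝ p μ, Integrable (fun x => g x (w x)) μ) :
    WeaklyGammaConverges (fun k u => ∫ x, f k x (T u x) ∂μ + ∫ x, g x (S u x) ∂μ)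
      (fun u => ∫ x, f₀ x (T u x) ∂μ + ∫ x, g x (S u x) ∂μ) := by
  have hp₀ : p ≠ 0 := (zero_lt_one.trans hp₁).ne'
  refine weaklyGammaConverges_of_tendsto (fun u => (tendsto_integral h h₀ hp₁ hp₂ hc₀.le hc₁ ha₀ ha₁
    hi₀ hi₁ hlim (Lp.memLp (T u))).add_const _) fun u t ht => ?_
  set ε := (∫ x, f₀ x (T u x) ∂μ + ∫ x, g x (S u x) ∂μ - t) / 2 with hε
  have hε0 : 0 < ε := by linarith
  obtain ⟨U₁, hU₁, hev⟩ := exists_weak_nhds h h₀ hp₁ hp₂ hc₀ hc₁ ha₀ ha₁ hi₀ hi₁ hlim T u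
    (sub_lt_self _ hε0)
  have hgb : ∀ᵐ x ∂μ, ∀ s, -b₀ x ≤ g x s := by
    filter_upwards [hg] with x hx s
    have h1 : 0 ≤ d₀ * |s| ^ p.toReal := by positivity
    linarith [hx s]
  have hN : ∀ᶠ v in 𝓝 (S u), ∫ x, g x (S u x) ∂μ - ε < ∫ x, g x (v x) ∂μ :=
    eventually_lt_integral_caratheodory_comp hgc hb₀ hgb hgi (S u) (sub_lt_self _ hε0)
  -- Outside a ball of radius `R`, coercivity alone gives the lower bound.
  obtain ⟨R, hR⟩ := exists_le_mul_rpow_sub_mul (ENNReal.one_lt_toReal hp₁ hp₂) (lt_min hc₀ hd₀) 0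
    (t + ∫ x, a₀ x ∂μ + ∫ x, b₀ x ∂μ)
  obtain ⟨U₂, hU₂, hcpt⟩ := hS.exists_weak_nhds R u hN
  refine ⟨U₁ ∩ U₂, inter_mem hU₁ hU₂, ?_⟩
  filter_upwards [hev] with k hk w hw
  rcases le_total R ‖w‖ with hRw | hRw
  · have h1 := hR _ hRw
    rw [zero_mul, sub_zero, hnorm, Lp.norm_rpow_eq_integral hp₀ hp₂,
      Lp.norm_rpow_eq_integral hp₀ hp₂] at h1
    have h2 := (h k).le_integral hp₁ hp₂ hi₀ (Lp.memLp (T w))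
      ((h k).integrable_comp hp₁ hp₂ hc₀.le hc₁ ha₀ ha₁ hi₀ hi₁ (Lp.memLp (T w)))
    have h3 : d₀ * ∫ x, ‖S w x‖ ^ p.toReal ∂μ - ∫ x, b₀ x ∂μ ≤ ∫ x, g x (S w x) ∂μ := by
      have h4 := ((Lp.memLp (S w)).integrable_norm_rpow hp₀ hp₂).const_mul d₀
      rw [← integral_const_mul, ← integral_sub h4 hb₀]
      refine integral_mono_ae (h4.sub hb₀) (hgi _) ?_
      filter_upwards [hg] with x hx using hx _
    have h5 : 0 ≤ ∫ x, ‖S w x‖ ^ p.toReal ∂μ := integral_nonneg fun x => by positivity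
    have h6 : 0 ≤ ∫ x, ‖T w x‖ ^ p.toReal ∂μ := integral_nonneg fun x => by positivity
    have h7 := mul_le_mul_of_nonneg_right (min_le_right c₀ d₀) h5
    have h8 := mul_le_mul_of_nonneg_right (min_le_left c₀ d₀) h6
    linarith
  · have h1 := hk w hw.1
    have h2 : ∫ x, g x (S u x) ∂μ - ε < ∫ x, g x (S w x) ∂μ := hcpt w hw.2 hRw
    linarith

end BoundedOperator

/-! ### The functionals on the Sobolev space -/

lemma IntegrandClass.isConvexIntegrand {n m : ℕ} {p : ℝ≥0∞} {Ω : Set (EuclideanSpace ℝ (Fin n))}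
    {c₀ c₁ : ℝ} {a₀ a₁ : EuclideanSpace ℝ (Fin n) → ℝ}
    {f : EuclideanSpace ℝ (Fin n) → EuclideanSpace ℝ (Fin m) → ℝ} (hΩ : MeasurableSet Ω)
    (h : IntegrandClass p Ω c₀ c₁ a₀ a₁ f) :
    IsConvexIntegrand (volume.restrict Ω) p c₀ c₁ a₀ a₁ f where
  aemeasurable η := by
    rw [← map_comap_subtype_coe hΩ]
    exact (MeasurableEmbedding.subtype_coe hΩ).aemeasurable_map_iff.2 (h.measurable η).aemeasurable
  growth := by
    filter_upwards [h.convex, h.growth] with x hx hg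
    exact ⟨hx, fun η => (hg η).1, fun η => (hg η).2⟩

lemma HasGrowth.integrable_comp {n : ℕ} {p : ℝ≥0∞} {Ω : Set (EuclideanSpace ℝ (Fin n))}
    {d₀ d₁ : ℝ} {b₀ b₁ : EuclideanSpace ℝ (Fin n) → ℝ} {g : EuclideanSpace ℝ (Fin n) → ℝ → ℝ}
    (h : HasGrowth p Ω d₀ d₁ b₀ b₁ g) (hp₁ : 1 < p) (hp₂ : p ≠ ⊤) (hd₀ : 0 ≤ d₀) (hd₁ : 0 ≤ d₁)
    (hg : IsCaratheodory Ω g) {v : EuclideanSpace ℝ (Fin n) → ℝ}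
    (hv : MemLp v p (volume.restrict Ω)) : IntegrableOn (fun x => g x (v x)) Ω := by
  have h1 := (hv.integrable_norm_rpow (by positivity) hp₂).const_mul d₁
  refine ((h1.add h.integrable₀).add h.integrable₁).mono'
    (AEMeasurable.caratheodory_comp hg.1 hg.2 hv.1).aestronglyMeasurable ?_
  filter_upwards [h.growth, h.nonneg₀, h.nonneg₁] with x hx hx0 hx1
  obtain ⟨h2, h3⟩ := hx (v x)
  have h4 : 0 ≤ d₀ * |v x| ^ p.toReal := by positivity
  have h5 : 0 ≤ d₁ * |v x| ^ p.toReal := by positivity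
  simp only [Pi.add_apply, Real.norm_eq_abs]
  rw [abs_le]
  constructor <;> linarith

lemma Submodule.norm_rpow_withLp_prod {A B : Type*} [NormedAddCommGroup A] [NormedSpace ℝ A]
    [NormedAddCommGroup B] [NormedSpace ℝ B] {p : ℝ≥0∞} [Fact (1 ≤ p)] (hp₀ : p ≠ 0) (hp : p ≠ ⊤)
    (W : Submodule ℝ (WithLp p (A × B))) (w : W) :
    ‖w‖ ^ p.toReal = ‖w.1.fst‖ ^ p.toReal + ‖w.1.snd‖ ^ p.toReal := by
  rw [Submodule.coe_norm, WithLp.prod_norm_eq_add (ENNReal.toReal_pos hp₀ hp),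
    ← Real.rpow_mul (by positivity), one_div, inv_mul_cancel₀ (ENNReal.toReal_pos hp₀ hp).ne',
    Real.rpow_one]

namespace WX

variable {n m : ℕ} {p : ℝ≥0∞} [Fact (1 ≤ p)]
  {X : Fin m → EuclideanSpace ℝ (Fin n) → EuclideanSpace ℝ (Fin n)}
  {Ω : Set (EuclideanSpace ℝ (Fin n))}

variable (p X Ω) in
/-- The embedding of `W^{1,p}_X(Ω)` into `L^p(Ω)` as a bounded operator. -/
noncomputable def fnL : WX p X Ω →L[ℝ] Lp ℝ p (volume.restrict Ω) :=
  (WithLp.fstL p ℝ _ _).comp (WX p X Ω).subtypeL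

variable (p X Ω) in
/-- The `X`-gradient as a bounded operator from `W^{1,p}_X(Ω)` to `L^p(Ω; ℝᵐ)`. -/
noncomputable def gradL :
    WX p X Ω →L[ℝ] Lp (EuclideanSpace ℝ (Fin m)) p (volume.restrict Ω) :=
  (WithLp.sndL p ℝ _ _).comp (WX p X Ω).subtypeL

lemma norm_rpow (hp₀ : p ≠ 0) (hp : p ≠ ⊤) (w : WX p X Ω) :
    ‖w‖ ^ p.toReal = ‖fnL p X Ω w‖ ^ p.toReal + ‖gradL p X Ω w‖ ^ p.toReal :=
  Submodule.norm_rpow_withLp_prod hp₀ hp _ w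

end WX

theorem theorem3p1 {n m : ℕ} (p : ℝ≥0∞) [Fact (1 ≤ p)] (hp₁ : 1 < p) (hp₂ : p ≠ ⊤)
    (Ω Ω₀ : Set (EuclideanSpace ℝ (Fin n))) (hΩ : IsOpen Ω) (hΩb : Bornology.IsBounded Ω)
    (hΩ₀ : IsOpen Ω₀) (hΩΩ₀ : closure Ω ⊆ Ω₀)
    (X : Fin m → EuclideanSpace ℝ (Fin n) → EuclideanSpace ℝ (Fin n))
    (hX : LipschitzFields X Ω₀) (hLIC : LIC X Ω)
    (hH1 : CondH1 X Ω₀) (hH2 : CondH2 X Ω₀) (hH3 : CondH3 X Ω₀)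
    (c₀ c₁ : ℝ) (a₀ a₁ : EuclideanSpace ℝ (Fin n) → ℝ)
    (ha₀ : MemLp a₀ ⊤ (volume.restrict Ω)) (ha₁ : MemLp a₁ ⊤ (volume.restrict Ω))
    (fh : ℕ → EuclideanSpace ℝ (Fin n) → EuclideanSpace ℝ (Fin m) → ℝ)
    (f : EuclideanSpace ℝ (Fin n) → EuclideanSpace ℝ (Fin m) → ℝ)
    (hfh : ∀ h, IntegrandClass p Ω c₀ c₁ a₀ a₁ (fh h)) (hf : IntegrandClass p Ω c₀ c₁ a₀ a₁ f)
    (hlim : ∀ η, ∀ᵐ x ∂(volume.restrict Ω), Tendsto (fun h => fh h x η) atTop (𝓝 (f x η))) :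
    -- the functionals are well defined and finite
    (∀ u : WX p X Ω, (∀ h, IntegrableOn (fun x => fh h x (WX.grad u x)) Ω) ∧
      IntegrableOn (fun x => f x (WX.grad u x)) Ω) ∧
    WeaklyGammaConverges (E := WX0 p X Ω)
      (fun h u => gradFunctional (fh h) (u : WX p X Ω))
      (fun u => gradFunctional f (u : WX p X Ω)) ∧
    (CompactlyEmbedded p X Ω →
      ∀ (g : EuclideanSpace ℝ (Fin n) → ℝ → ℝ) (d₀ d₁ : ℝ) (b₀ b₁ : EuclideanSpace ℝ (Fin n) → ℝ),
        0 < d₀ → d₀ ≤ d₁ → IsCaratheodory Ω g → HasGrowth p Ω d₀ d₁ b₀ b₁ g →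
        (∀ u : WX p X Ω, IntegrableOn (fun x => g x (WX.fn u x)) Ω) ∧
        WeaklyGammaConverges (E := WX p X Ω)
          (fun h u => gradFunctional (fh h) u + datumFunctional g u)
          (fun u => gradFunctional f u + datumFunctional g u)) := by
  have hp₀ : p ≠ 0 := (zero_lt_one.trans hp₁).ne'
  have hc₀ : 0 < c₀ := hf.pos
  have hc₁ : 0 ≤ c₁ := hc₀.le.trans hf.le
  have hfin : IsFiniteMeasure (volume.restrict Ω) := ⟨by
    rw [Measure.restrict_apply_univ]; exact hΩb.measure_lt_top⟩
  have hF : ∀ h, IsConvexIntegrand (volume.restrict Ω) p c₀ c₁ a₀ a₁ (fh h) := fun h =>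
    (hfh h).isConvexIntegrand hΩ.measurableSet
  have hF₀ : IsConvexIntegrand (volume.restrict Ω) p c₀ c₁ a₀ a₁ f :=
    hf.isConvexIntegrand hΩ.measurableSet
  have hint : ∀ {k : EuclideanSpace ℝ (Fin n) → EuclideanSpace ℝ (Fin m) → ℝ},
      IsConvexIntegrand (volume.restrict Ω) p c₀ c₁ a₀ a₁ k → ∀ u : WX p X Ω,
      IntegrableOn (fun x => k x (WX.grad u x)) Ω := fun hk u =>
    hk.integrable_comp hp₁ hp₂ hc₀.le hc₁ hf.nonneg₀ hf.nonneg₁ hf.integrable₀ hf.integrable₁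
      (Lp.memLp _)
  refine ⟨fun u => ⟨fun h => hint (hF h) u, hint hF₀ u⟩, ?_, ?_⟩
  · exact IsConvexIntegrand.weaklyGammaConverges_submodule hF hF₀ hp₁ hp₂ hc₀ hc₁ hf.nonneg₀
      hf.nonneg₁ hf.integrable₀ hf.integrable₁ hlim (WX.gradL p X Ω) (WX0 p X Ω)
  · intro hcomp g d₀ d₁ b₀ b₁ hd₀ hd hg hgr
    have hgi : ∀ v : Lp ℝ p (volume.restrict Ω), IntegrableOn (fun x => g x (v x)) Ω := fun v =>
      hgr.integrable_comp hp₁ hp₂ hd₀.le (hd₀.le.trans hd) hg (Lp.memLp v)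
    refine ⟨fun u => hgi _, ?_⟩
    exact IsConvexIntegrand.weaklyGammaConverges_add hF hF₀ hp₁ hp₂ hc₀ hc₁ hf.nonneg₀ hf.nonneg₁
      hf.integrable₀ hf.integrable₁ hlim (WX.gradL p X Ω) (S := WX.fnL p X Ω) hcomp
      (WX.norm_rpow hp₀ hp₂) hd₀ hg.2 hgr.integrable₀
      (hgr.growth.mono fun x hx s => (hx s).1) hgi
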